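/- Let $\Bbbk$ be a field. A language $\Omega$ is a set of operation symbols $f$ with arities $\nu(f)\ge 2$; $\mathcal F_\Omega$ is the free symmetric operad generated by $\Omega$ ($\mathcal F_\Omega(n)$ is the space of polylinear polynomials of type $\Omega$ in $x_1,\dots,x_n$). $\mathrm{Perm}$ is the operad with $\mathrm{Perm}(n)=\Bbbk^n$ with standard basis $e^{(n)}_1,\dots,e^{(n)}_n$, composition $e^{(n)}_k(e^{(m_1)}_{j_1},\dots,e^{(m_n)}_{j_n})=e^{(m_1+\dots+m_n)}_{m_1+\dots+m_{k-1}+j_k}$ and $S_n$ permuting the basis. For an operad $\mathcal P$ put $\mathrm{di}\mathcal P=\mathcal P\otimes\mathrm{Perm}$ (Hadamard product). For a morphism of operads $\omega:\mathcal P\to\mathcal R$, a $\mathcal P$-algebra is $\omega$-special if its structure morphism $\mathcal P\to\mathrm{End}(A)$ is $\beta\circ\omega$ for an $\mathcal R$-algebra structure $\beta:\mathcal R\to\mathrm{End}(A)$ on the same space; $S^\omega\mathcal P$ denotes the quotient operad of $\mathcal P$ by all polylinear identities that hold on the variety of homomorphic images of subalgebras of $\omega$-special $\mathcal P$-algebras,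 and $S^\omega:\mathcal P\to S^\omega\mathcal P$ is the quotient morphism. **Theorem.** Let $\pi:\mathcal F_\Omega\to\mathcal P$ and $\rho:\mathcal F_\Xi\to\mathcal R$ be surjective morphisms of operads and let $\omega:\mathcal P\to\mathcal R$ be a morphism of operads. (1) If $\mathrm{char}\,\Bbbk=0$, then $\mathrm{di}S^\omega\mathcal P=S^{\omega\otimes\mathrm{id}}\mathrm{di}\mathcal P$ as quotients of $\mathrm{di}\mathcal P$: there is an isomorphism of operads $\mathrm{di}S^\omega\mathcal P\to S^{\omega\otimes\mathrm{id}}\mathrm{di}\mathcal P$ whose composition with $S^\omega\otimes\mathrm{id}$ is the quotient morphism $S^{\omega\otimes\mathrm{id}}:\mathrm{di}\mathcal P\to S^{\omega\otimes\mathrm{id}}\mathrm{di}\mathcal P$. (2) If $\mathrm{char}\,\Bbbk=p>0$, then for every $d<p$ the polylinear identities of degree $d$ that hold on all $\mathrm{di}S^\omega\mathcal P$-algebras are the same as those that hold on all $S^{\omega\otimes\mathrm{id}}\mathrm{di}\mathcal P$-algebras. Here identities are elements of $\mathcal F_{\Omega^{(2)}}(d)$, where $\Omega^{(2)}$ consists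 of symbols $f^k$ ($f\in\Omega$, $1\le k\le\nu(f)$) of arity $\nu(f)$, interpreted by the morphism $\mathcal F_{\Omega^{(2)}}\to\mathrm{di}\mathcal F_\Omega\to\mathrm{di}\mathcal P$, $f^k\mapsto f\otimes e_k\mapsto\pi(f)\otimes e_k$. Moreover, this solves the two problems of Bremner, Felipe and Sánchez-Ortega. Let $n\ge2$, $\alpha_\sigma\in\Bbbk$ ($\sigma\in S_n$), and let $\mathrm{Id}(\omega)$ be the set of polylinear identities of all $n$-ary algebras obtained from associative algebras by the operation $\omega(x_1,\dots,x_n)=\sum_\sigma\alpha_\sigma x_{\sigma(1)}\cdots x_{\sigma(n)}$. Let $\mathrm{Id}(\mathrm{BSO}(\omega))$ be the set of polylinear identities of all algebras obtained from associative dialgebras by the $n$ operations $$\omega_i(x_1,\dots,x_n)=\sum_{j=1}^n\ \sum_{\sigma(j)=i}\alpha_\sigma\, x_{\sigma(1)}\vdash\dots\vdash x_{\sigma(j-1)}\vdash x_i\dashv x_{\sigma(j+1)}\dashv\dots\dashv x_{\sigma(n)},\qquad i=1,\dots,n.$$ For a set $S$ of polylinear identities of type $\Omega$ let $S^{(2)}$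 be the operad ideal of $\mathcal F_{\Omega^{(2)}}$ generated by all $f^k(\dots,g^l(\dots),\dots)-f^k(\dots,g^p(\dots),\dots)$ with $f,g\in\Omega$, $g$ in a position $j\ne k$, $1\le l,p\le\nu(g)$, and by all $s^k$, $s\in S$, $k$ the index of a variable of $s$. Here $s^k$ is obtained linearly from $s$ by giving each symbol in a monomial as superscript the number of its branch that contains $x_k$, or $1$ if no branch does. (3) If $\mathrm{char}\,\Bbbk=0$, then $\mathrm{Id}(\mathrm{BSO}(\omega))=\mathrm{Id}(\omega)^{(2)}$. (4) If $\mathrm{char}\,\Bbbk=p>0$ and $d<p$, then $\mathrm{Id}(\mathrm{BSO}(\omega))$ and $\mathrm{Id}(\omega)^{(2)}$ have the same elements of degree $d$. -/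

import Mathlib

open scoped TensorProduct

universe u

namespace Dialg

universe v v' w

section Multilinear

variable {k : Type u} [Field k]

/-- Multilinear extension of a map of bases `φ`. -/
noncomputable def basisComp {S : Type*} {ι : Type} [Finite ι] {T : ι → Type*} {U : Type*}
    (φ : S → (∀ i, T i) → U) :
    (S →₀ k) →ₗ[k] MultilinearMap k (fun i => T i →₀ k) (U →₀ k) :=
  Finsupp.lift _ k S fun s =>
    ((Module.Basis.constr (Basis.piTensorProduct
        (fun i => (Finsupp.basisSingleOne : Module.Basis (T i) k (T i →₀ k)))) k)
      (fun t => Finsupp.single (φ s t) (1 : k))).compMultilinearMap (PiTensorProduct.tprod k)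

theorem basisComp_single {S : Type*} {ι : Type} [Finite ι] {T : ι → Type*} {U : Type*}
    (φ : S → (∀ i, T i) → U) (s : S) (t : ∀ i, T i) :
    basisComp (k := k) φ (Finsupp.single s 1) (fun i => Finsupp.single (t i) 1) =
      Finsupp.single (φ s t) 1 := by
  have := Module.Basis.constr_basis (Basis.piTensorProduct
        (fun i => (Finsupp.basisSingleOne : Module.Basis (T i) k (T i →₀ k)))) k
      (fun t => Finsupp.single (φ s t) (1 : k)) t
  simp only [Basis.piTensorProduct_apply, Finsupp.coe_basisSingleOne] at this
  simp [basisComp, this]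

section tmul
variable {ι : Type} [Finite ι] {M N : ι → Type*} {A B : Type*}
  [∀ i, AddCommGroup (M i)] [∀ i, Module k (M i)] [∀ i, AddCommGroup (N i)]
  [∀ i, Module k (N i)] [AddCommGroup A] [Module k A] [AddCommGroup B] [Module k B]

theorem span_tmul_range (X Y : Type*) [AddCommGroup X] [Module k X] [AddCommGroup Y] [Module k Y] :
    Submodule.span k (Set.range fun p : X × Y => p.1 ⊗ₜ[k] p.2) = ⊤ := by
  rw [← TensorProduct.span_tmul_eq_top]
  congr 1
  ext; simp

/-- The multilinear map `(xᵢ ⊗ yᵢ)ᵢ ↦ f x ⊗ g y`, written in a basis. -/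
noncomputable def tmulAux (f : MultilinearMap k M A) (g : MultilinearMap k N B) :
    MultilinearMap k (fun i => M i ⊗[k] N i) (A ⊗[k] B) :=
  ((Module.Basis.constr (Basis.piTensorProduct (fun i =>
      (Module.Basis.ofVectorSpace k (M i)).tensorProduct (Module.Basis.ofVectorSpace k (N i)))) k)
    (fun p => f (fun i => Module.Basis.ofVectorSpace k (M i) (p i).1) ⊗ₜ
      g (fun i => Module.Basis.ofVectorSpace k (N i) (p i).2))).compMultilinearMap
    (PiTensorProduct.tprod k)

theorem tmulAux_tmul (f : MultilinearMap k M A) (g : MultilinearMap k N B)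
    (x : ∀ i, M i) (y : ∀ i, N i) :
    tmulAux f g (fun i => x i ⊗ₜ y i) = f x ⊗ₜ g y := by
  have h1 : ∀ (p : ∀ i, Module.Basis.ofVectorSpaceIndex k (M i))
      (q : ∀ i, Module.Basis.ofVectorSpaceIndex k (N i)),
      tmulAux f g (fun i => Module.Basis.ofVectorSpace k (M i) (p i) ⊗ₜ
        Module.Basis.ofVectorSpace k (N i) (q i)) =
      f (fun i => Module.Basis.ofVectorSpace k (M i) (p i)) ⊗ₜ
        g (fun i => Module.Basis.ofVectorSpace k (N i) (q i)) := by
    intro p q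
    have := Module.Basis.constr_basis (Basis.piTensorProduct (fun i =>
      (Module.Basis.ofVectorSpace k (M i)).tensorProduct (Module.Basis.ofVectorSpace k (N i)))) k
      (fun p => f (fun i => Module.Basis.ofVectorSpace k (M i) (p i).1) ⊗ₜ[k]
      g (fun i => Module.Basis.ofVectorSpace k (N i) (p i).2)) (fun i => (p i, q i))
    rw [Basis.piTensorProduct_apply] at this
    simpa [tmulAux, Module.Basis.tensorProduct_apply] using this
  have h2 : ∀ (p : ∀ i, Module.Basis.ofVectorSpaceIndex k (M i)) (y : ∀ i, N i),
      tmulAux f g (fun i => Module.Basis.ofVectorSpace k (M i) (p i) ⊗ₜ y i) =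
      f (fun i => Module.Basis.ofVectorSpace k (M i) (p i)) ⊗ₜ g y := by
    intro p y
    have := Module.Basis.ext_multilinear
      (f := (tmulAux f g).compLinearMap (fun i => TensorProduct.mk k (M i) (N i)
        (Module.Basis.ofVectorSpace k (M i) (p i))))
      (g := (TensorProduct.mk k A B (f (fun i => Module.Basis.ofVectorSpace k (M i) (p i)))).compMultilinearMap g)
      (fun i => Module.Basis.ofVectorSpace k (N i)) (fun q => by simpa using h1 p q)
    simpa using congrArg (fun m => m y) this
  have := Module.Basis.ext_multilinear
      (f := (tmulAux f g).compLinearMap (fun i => (TensorProduct.mk k (M i) (N i)).flip (y i)))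
      (g := ((TensorProduct.mk k A B).flip (g y)).compMultilinearMap f)
      (fun i => Module.Basis.ofVectorSpace k (M i)) (fun q => by simpa using h2 q y)
  simpa using congrArg (fun m => m x) this

theorem ext_tmul {C : Type*} [AddCommGroup C] [Module k C]
    {φ ψ : MultilinearMap k (fun i => M i ⊗[k] N i) C}
    (h : ∀ (x : ∀ i, M i) (y : ∀ i, N i), φ (fun i => x i ⊗ₜ y i) = ψ (fun i => x i ⊗ₜ y i)) : φ = ψ :=
  MultilinearMap.ext_of_span_eq_top (g := fun i (p : M i × N i) => p.1 ⊗ₜ[k] p.2)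
    (fun _ => span_tmul_range _ _) (fun j => h (fun i => (j i).1) (fun i => (j i).2))

/-- The map `f ⊗ g ↦ ((xᵢ ⊗ yᵢ)ᵢ ↦ f x ⊗ g y)`. -/
noncomputable def tmulMultilinear :
    (MultilinearMap k M A) →ₗ[k] (MultilinearMap k N B) →ₗ[k]
      MultilinearMap k (fun i => M i ⊗[k] N i) (A ⊗[k] B) :=
  LinearMap.mk₂ k tmulAux
    (fun f f' g => ext_tmul fun x y => by simp [tmulAux_tmul, TensorProduct.add_tmul])
    (fun c f g => ext_tmul fun x y => by simp [tmulAux_tmul, TensorProduct.smul_tmul'])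
    (fun f g g' => ext_tmul fun x y => by simp [tmulAux_tmul, TensorProduct.tmul_add])
    (fun c f g => ext_tmul fun x y => by simp [tmulAux_tmul])

theorem tmulMultilinear_tmul (f : MultilinearMap k M A) (g : MultilinearMap k N B)
    (x : ∀ i, M i) (y : ∀ i, N i) :
    tmulMultilinear f g (fun i => x i ⊗ₜ y i) = f x ⊗ₜ g y := tmulAux_tmul f g x y

end tmul

section span
variable {ι : Type} [Finite ι] {M W : ι → Type*} {A X Y Z : Type*}
  [∀ i, AddCommGroup (M i)] [∀ i, Module k (M i)] [∀ i, AddCommGroup (W i)]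
  [∀ i, Module k (W i)] [AddCommGroup A] [Module k A] [AddCommGroup X] [Module k X]
  [AddCommGroup Y] [Module k Y] [AddCommGroup Z] [Module k Z]

theorem ext_span₂ {γA : Type*} {gA : γA → A} (hA : Submodule.span k (Set.range gA) = ⊤)
    {γ : ι → Type*} {g : ∀ i, γ i → M i} (hg : ∀ i, Submodule.span k (Set.range (g i)) = ⊤)
    {φ ψ : A →ₗ[k] MultilinearMap k M X}
    (h : ∀ (a : γA) (b : ∀ i, γ i), φ (gA a) (fun i => g i (b i)) = ψ (gA a) (fun i => g i (b i))) : φ = ψ := by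
  refine LinearMap.ext_on_range hA fun a => ?_
  exact MultilinearMap.ext_of_span_eq_top (g := fun i => g i) hg (h a)

theorem assoc_of_span {J : ι → Type} [∀ i, Finite (J i)] {N : ∀ i, J i → Type*}
    [∀ i j, AddCommGroup (N i j)] [∀ i j, Module k (N i j)]
    (c₁ : A →ₗ[k] MultilinearMap k M X)
    (c₂ : X →ₗ[k] MultilinearMap k (fun p : Σ i, J i => N p.1 p.2) Y)
    (m : Y →ₗ[k] Z)
    (c₃ : ∀ i, M i →ₗ[k] MultilinearMap k (N i) (W i))
    (c₄ : A →ₗ[k] MultilinearMap k W Z)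
    {γA : Type*} {gA : γA → A} (hA : Submodule.span k (Set.range gA) = ⊤)
    {γ : ι → Type*} {g : ∀ i, γ i → M i} (hg : ∀ i, Submodule.span k (Set.range (g i)) = ⊤)
    {γ' : ∀ i, J i → Type*} {g' : ∀ i j, γ' i j → N i j}
    (hg' : ∀ i j, Submodule.span k (Set.range (g' i j)) = ⊤)
    (h : ∀ a (b : ∀ i, γ i) (c : ∀ i j, γ' i j),
      m (c₂ (c₁ (gA a) (fun i => g i (b i))) (fun p => g' p.1 p.2 (c p.1 p.2))) =
        c₄ (gA a) (fun i => c₃ i (g i (b i)) (fun j => g' i j (c i j))))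
    (a : A) (b : ∀ i, M i) (c : ∀ p : Σ i, J i, N p.1 p.2) :
    m (c₂ (c₁ a b) c) = c₄ a (fun i => c₃ i (b i) (fun j => c ⟨i, j⟩)) := by
  have e1 : ∀ (c : ∀ i j, γ' i j) (a : A) (b : ∀ i, M i),
      m (c₂ (c₁ a b) (fun p => g' p.1 p.2 (c p.1 p.2))) =
        c₄ a (fun i => c₃ i (b i) (fun j => g' i j (c i j))) := by
    intro c a b
    let ev : X →ₗ[k] Z :=
      { toFun := fun x => m (c₂ x (fun p => g' p.1 p.2 (c p.1 p.2)))
        map_add' := by intros; simp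
        map_smul' := by intros; simp }
    let ev' : ∀ i, M i →ₗ[k] W i := fun i =>
      { toFun := fun x => c₃ i x (fun j => g' i j (c i j))
        map_add' := by intros; simp
        map_smul' := by intros; simp }
    let φ : A →ₗ[k] MultilinearMap k M Z :=
      { toFun := fun a => ev.compMultilinearMap (c₁ a)
        map_add' := by intros; ext; simp
        map_smul' := by intros; ext; simp }
    let ψ : A →ₗ[k] MultilinearMap k M Z :=
      { toFun := fun a => (c₄ a).compLinearMap ev'
        map_add' := by intros; ext; simp
        map_smul' := by intros; ext; simp }
    have : φ = ψ := ext_span₂ hA hg (fun a b => h a b c)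
    exact congrArg (fun t : A →ₗ[k] MultilinearMap k M Z => t a b) this
  have e2 : m.compMultilinearMap (c₂ (c₁ a b)) =
      (c₄ a).compMultilinearMap (fun i => c₃ i (b i)) := by
    refine MultilinearMap.ext_of_span_eq_top (g := fun p : Σ i, J i => g' p.1 p.2)
      (fun p => hg' _ _) (fun j => ?_)
    exact e1 (fun i l => j ⟨i, l⟩) a b
  exact congrArg (fun t : MultilinearMap k (fun p : Σ i, J i => N p.1 p.2) Z => t c) e2

theorem inner_of_span (c₁ : A →ₗ[k] MultilinearMap k M X) (m : X →ₗ[k] Z)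
    (l : ∀ i, M i →ₗ[k] W i) (c₂ : A →ₗ[k] MultilinearMap k W Z)
    {γA : Type*} {gA : γA → A} (hA : Submodule.span k (Set.range gA) = ⊤)
    {γ : ι → Type*} {g : ∀ i, γ i → M i} (hg : ∀ i, Submodule.span k (Set.range (g i)) = ⊤)
    (h : ∀ (a : γA) (b : ∀ i, γ i), m (c₁ (gA a) (fun i => g i (b i))) = c₂ (gA a) (fun i => l i (g i (b i))))
    (a : A) (b : ∀ i, M i) : m (c₁ a b) = c₂ a (fun i => l i (b i)) := by
  let φ : A →ₗ[k] MultilinearMap k M Z :=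
    { toFun := fun a => m.compMultilinearMap (c₁ a)
      map_add' := by intros; ext; simp
      map_smul' := by intros; ext; simp }
  let ψ : A →ₗ[k] MultilinearMap k M Z :=
    { toFun := fun a => (c₂ a).compLinearMap l
      map_add' := by intros; ext; simp
      map_smul' := by intros; ext; simp }
  have : φ = ψ := ext_span₂ hA hg h
  exact congrArg (fun t : A →ₗ[k] MultilinearMap k M Z => t a b) this

theorem outer_of_span {ι' : Type} [Finite ι'] (e : ι' ≃ ι)
    (c₁ : A →ₗ[k] MultilinearMap k (fun i' => M (e i')) X) (m : X →ₗ[k] Z)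
    (l : A →ₗ[k] Y) (c₂ : Y →ₗ[k] MultilinearMap k M Z)
    {γA : Type*} {gA : γA → A} (hA : Submodule.span k (Set.range gA) = ⊤)
    {γ : ι → Type*} {g : ∀ i, γ i → M i} (hg : ∀ i, Submodule.span k (Set.range (g i)) = ⊤)
    (h : ∀ a (b : ∀ i, γ i),
      m (c₁ (gA a) (fun i => g (e i) (b (e i)))) = c₂ (l (gA a)) (fun i => g i (b i)))
    (a : A) (b : ∀ i, M i) : m (c₁ a (fun i => b (e i))) = c₂ (l a) b := by
  let pre : MultilinearMap k (fun i' => M (e i')) X → MultilinearMap k M Z := fun c =>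
    { toFun := fun b => m (c (fun i => b (e i)))
      map_update_add' := by
        intro _ b i x y
        classical
        obtain ⟨i, rfl⟩ := e.surjective i
        have : ∀ z, (fun i' => Function.update b (e i) z (e i')) =
            Function.update (fun i' => b (e i')) i z := by
          intro z; funext i'
          by_cases hi : i' = i
          · subst hi; simp
          · simp [hi]
        have h3 := c.map_update_add (fun i' => b (e i')) i x y
        have : ∀ z, (fun i' => Function.update b (e i) z (e i')) =
            Function.update (fun i' => b (e i')) i z := this
        convert congrArg m h3 using 2
        · congr 1; convert this (x + y)
        · rw [map_add]; congr 3
          · convert this x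
          · convert this y
      map_update_smul' := by
        intro _ b i r x
        classical
        obtain ⟨i, rfl⟩ := e.surjective i
        have : ∀ z, (fun i' => Function.update b (e i) z (e i')) =
            Function.update (fun i' => b (e i')) i z := by
          intro z; funext i'
          by_cases hi : i' = i
          · subst hi; simp
          · simp [hi]
        have h3 := c.map_update_smul (fun i' => b (e i')) i r x
        convert congrArg m h3 using 2
        · congr 1; convert this (r • x)
        · rw [map_smul]; congr 3
          convert this x }
  let φ : A →ₗ[k] MultilinearMap k M Z :=
    { toFun := fun a => pre (c₁ a)
      map_add' := by intros; ext; simp [pre]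
      map_smul' := by intros; ext; simp [pre] }
  have : φ = c₂ ∘ₗ l := ext_span₂ hA hg h
  exact congrArg (fun t : A →ₗ[k] MultilinearMap k M Z => t a b) this

end span

end Multilinear

/-! ### Symmetric operads -/

/-- A symmetric `k`-linear operad, presented on finite sets: `obj I` is the space of operations whose
inputs are labelled by the finite set `I`, so `obj (Fin n)` is the usual `P(n)`, the symmetric
group acts through `map`, and `comp a b` is the simultaneous substitution `γ(a; (b i)_i)`, whose
inputs are the pairs `(i, j)` with `j` an input of `b i`. -/
structure Operad (k : Type u) [Field k] where
  obj : (I : Type) → [Finite I] → Type v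
  [grp : ∀ (I : Type) [Finite I], AddCommGroup (obj I)]
  [mod : ∀ (I : Type) [Finite I], Module k (obj I)]
  map : ∀ {I J : Type} [Finite I] [Finite J], I ≃ J → obj I →ₗ[k] obj J
  one : obj Unit
  comp : ∀ {I : Type} [Finite I] {J : I → Type} [∀ i, Finite (J i)],
    obj I →ₗ[k] MultilinearMap k (fun i => obj (J i)) (obj (Σ i, J i))
  map_refl : ∀ {I : Type} [Finite I] (a : obj I), map (Equiv.refl I) a = a
  map_trans : ∀ {I J K : Type} [Finite I] [Finite J] [Finite K] (e : I ≃ J) (e' : J ≃ K)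
    (a : obj I), map (e.trans e') a = map e' (map e a)
  map_inner : ∀ {I : Type} [Finite I] {J J' : I → Type} [∀ i, Finite (J i)] [∀ i, Finite (J' i)]
    (ε : ∀ i, J i ≃ J' i) (a : obj I) (b : ∀ i, obj (J i)),
    map (Equiv.sigmaCongrRight ε) (comp a b) = comp a (fun i => map (ε i) (b i))
  map_outer : ∀ {I I' : Type} [Finite I] [Finite I'] {J : I' → Type} [∀ i, Finite (J i)]
    (e : I ≃ I') (a : obj I) (b : ∀ i, obj (J i)),
    map (Equiv.sigmaCongrLeft e) (comp a (fun i => b (e i))) = comp (map e a) b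
  one_comp : ∀ {I : Type} [Finite I] (a : obj I),
    map (Equiv.uniqueSigma fun _ : Unit => I) (comp one (fun _ => a)) = a
  comp_one : ∀ {I : Type} [Finite I] (a : obj I),
    map (Equiv.sigmaUnique I fun _ => Unit) (comp a (fun _ => one)) = a
  assoc : ∀ {I : Type} [Finite I] {J : I → Type} [∀ i, Finite (J i)]
    {L : ∀ i, J i → Type} [∀ i j, Finite (L i j)]
    (a : obj I) (b : ∀ i, obj (J i)) (c : ∀ p : Σ i, J i, obj (L p.1 p.2)),
    map (Equiv.sigmaAssoc L) (comp (comp a b) c) =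
      comp a (fun i => comp (b i) (fun j => c ⟨i, j⟩))

attribute [instance] Operad.grp Operad.mod

/-- A morphism of operads. -/
structure Operad.Hom {k : Type u} [Field k] (P : Operad.{u, v} k) (Q : Operad.{u, v'} k) where
  toFun : ∀ (I : Type) [Finite I], P.obj I →ₗ[k] Q.obj I
  map_map : ∀ {I J : Type} [Finite I] [Finite J] (e : I ≃ J) (a : P.obj I),
    toFun J (P.map e a) = Q.map e (toFun I a)
  map_one : toFun Unit P.one = Q.one
  map_comp : ∀ {I : Type} [Finite I] {J : I → Type} [∀ i, Finite (J i)]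
    (a : P.obj I) (b : ∀ i, P.obj (J i)),
    toFun (Σ i, J i) (P.comp a b) = Q.comp (toFun I a) (fun i => toFun (J i) (b i))

namespace Operad

variable {k : Type u} [Field k]

/-- The composition `g ∘ f` of morphisms of operads. -/
def Hom.comp {P : Operad.{u, v} k} {Q : Operad.{u, v'} k} {R : Operad.{u, w} k}
    (g : Hom Q R) (f : Hom P Q) : Hom P R where
  toFun I _ := g.toFun I ∘ₗ f.toFun I
  map_map e a := by simp [f.map_map, g.map_map]
  map_one := by simp [f.map_one, g.map_one]
  map_comp a b := by simp [f.map_comp, g.map_comp]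

/-- The identity morphism. -/
def Hom.id (P : Operad.{u, v} k) : Hom P P where
  toFun _ _ := LinearMap.id
  map_map _ _ := rfl
  map_one := rfl
  map_comp _ _ := rfl

/-- All components are surjective. -/
def Hom.Surjective {P : Operad.{u, v} k} {Q : Operad.{u, v'} k} (f : Hom P Q) : Prop :=
  ∀ (I : Type) [Finite I], Function.Surjective (f.toFun I)

/-- All components are bijective, so that the morphism is an isomorphism of operads. -/
def Hom.Bijective {P : Operad.{u, v} k} {Q : Operad.{u, v'} k} (f : Hom P Q) : Prop :=
  ∀ (I : Type) [Finite I], Function.Bijective (f.toFun I)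

/-- The operad of endomorphisms of a vector space. -/
def endo (k : Type u) [Field k] (A : Type v) [AddCommGroup A] [Module k A] :
    Operad.{u, v} k where
  obj I _ := MultilinearMap k (fun _ : I => A) A
  map e := (MultilinearMap.domDomCongrLinearEquiv k k A A e).toLinearMap
  one := (MultilinearMap.ofSubsingleton k A A ()) LinearMap.id
  comp {I _ J _} :=
    { toFun := fun f =>
        { toFun := fun g => f.compMultilinearMap g
          map_update_add' := by
            intro _ g i x y
            ext m
            have h : ∀ z : MultilinearMap k (fun _ : J i => A) A, (fun i' => (Function.update g i z i') (fun j => m ⟨i', j⟩)) =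
                Function.update (fun i' => g i' (fun j => m ⟨i', j⟩)) i (z (fun j => m ⟨i, j⟩)) := by
              intro z; funext i'
              by_cases hi : i' = i
              · subst hi; simp
              · simp [hi]
            change f (fun i' => (Function.update g i (x + y) i') (fun j => m ⟨i', j⟩)) =
              f (fun i' => (Function.update g i x i') (fun j => m ⟨i', j⟩)) +
              f (fun i' => (Function.update g i y i') (fun j => m ⟨i', j⟩))
            rw [h, h, h]
            exact f.map_update_add _ _ _ _
          map_update_smul' := by
            intro _ g i c x
            ext m
            have h : ∀ z : MultilinearMap k (fun _ : J i => A) A, (fun i' => (Function.update g i z i') (fun j => m ⟨i', j⟩)) =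
                Function.update (fun i' => g i' (fun j => m ⟨i', j⟩)) i (z (fun j => m ⟨i, j⟩)) := by
              intro z; funext i'
              by_cases hi : i' = i
              · subst hi; simp
              · simp [hi]
            change f (fun i' => (Function.update g i (c • x) i') (fun j => m ⟨i', j⟩)) =
              c • f (fun i' => (Function.update g i x i') (fun j => m ⟨i', j⟩))
            rw [h, h]
            exact f.map_update_smul _ _ _ _ }
      map_add' := by intros; ext; simp
      map_smul' := by intros; ext; simp }
  map_refl a := rfl
  map_trans e e' a := rfl
  map_inner ε a b := rfl
  map_outer e a b := by
    ext m
    rfl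
  one_comp a := rfl
  comp_one a := rfl
  assoc a b c := rfl

/-- Composition in the Hadamard product: `(a ⊗ a')((b i ⊗ b' i)_i) = a((b i)_i) ⊗ a'((b' i)_i)`. -/
noncomputable def hadamardComp (P : Operad.{u, v} k) (Q : Operad.{u, w} k) {I : Type} [Finite I]
    {J : I → Type} [∀ i, Finite (J i)] :
    P.obj I ⊗[k] Q.obj I →ₗ[k] MultilinearMap k (fun i => P.obj (J i) ⊗[k] Q.obj (J i))
      (P.obj (Σ i, J i) ⊗[k] Q.obj (Σ i, J i)) :=
  TensorProduct.lift (tmulMultilinear.compl₁₂ P.comp Q.comp)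

theorem hadamardComp_tmul (P : Operad.{u, v} k) (Q : Operad.{u, w} k) {I : Type} [Finite I]
    {J : I → Type} [∀ i, Finite (J i)] (a : P.obj I) (a' : Q.obj I) (b : ∀ i, P.obj (J i))
    (b' : ∀ i, Q.obj (J i)) :
    hadamardComp P Q (a ⊗ₜ[k] a') (fun i => b i ⊗ₜ[k] b' i) = P.comp a b ⊗ₜ[k] Q.comp a' b' := by
  simp [hadamardComp, tmulMultilinear_tmul]

theorem hadamardComp_assoc (P : Operad.{u, v} k) (Q : Operad.{u, w} k) {I : Type} [Finite I]
    {J : I → Type} [∀ i, Finite (J i)] {L : ∀ i, J i → Type} [∀ i j, Finite (L i j)]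
    (a : P.obj I ⊗[k] Q.obj I) (b : ∀ i, P.obj (J i) ⊗[k] Q.obj (J i))
    (c : ∀ p : Σ i, J i, P.obj (L p.1 p.2) ⊗[k] Q.obj (L p.1 p.2)) :
    TensorProduct.map (P.map (Equiv.sigmaAssoc L)) (Q.map (Equiv.sigmaAssoc L))
      (hadamardComp P Q (J := fun p : Σ i, J i => L p.1 p.2) (hadamardComp P Q a b) c) =
      hadamardComp P Q (J := fun i => Σ j, L i j) a
        (fun i => hadamardComp P Q (J := L i) (b i) (fun j => c ⟨i, j⟩)) := by
  refine assoc_of_span (M := fun i => P.obj (J i) ⊗[k] Q.obj (J i))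
    (N := fun i j => P.obj (L i j) ⊗[k] Q.obj (L i j))
    (W := fun i => P.obj (Σ j, L i j) ⊗[k] Q.obj (Σ j, L i j))
    (hadamardComp P Q) (hadamardComp P Q (J := fun p : Σ i, J i => L p.1 p.2))
    (TensorProduct.map (P.map (Equiv.sigmaAssoc L)) (Q.map (Equiv.sigmaAssoc L)))
    (fun i => hadamardComp P Q (J := L i))
    (hadamardComp P Q (J := fun i => Σ j, L i j))
    (span_tmul_range _ _) (fun i => span_tmul_range (P.obj (J i)) (Q.obj (J i)))
    (fun i j => span_tmul_range (P.obj (L i j)) (Q.obj (L i j))) ?_ a b c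
  intro a b c
  have h1 := P.assoc a.1 (fun i => (b i).1) (fun p => (c p.1 p.2).1)
  have h2 := Q.assoc a.2 (fun i => (b i).2) (fun p => (c p.1 p.2).2)
  simp only [hadamardComp_tmul, TensorProduct.map_tmul, h1, h2]

theorem hadamardComp_inner (P : Operad.{u, v} k) (Q : Operad.{u, w} k) {I : Type} [Finite I]
    {J J' : I → Type} [∀ i, Finite (J i)] [∀ i, Finite (J' i)] (ε : ∀ i, J i ≃ J' i)
    (a : P.obj I ⊗[k] Q.obj I) (b : ∀ i, P.obj (J i) ⊗[k] Q.obj (J i)) :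
    TensorProduct.map (P.map (Equiv.sigmaCongrRight ε)) (Q.map (Equiv.sigmaCongrRight ε))
      (hadamardComp P Q a b) =
      hadamardComp P Q a (fun i => TensorProduct.map (P.map (ε i)) (Q.map (ε i)) (b i)) := by
  refine inner_of_span (M := fun i => P.obj (J i) ⊗[k] Q.obj (J i))
    (W := fun i => P.obj (J' i) ⊗[k] Q.obj (J' i)) (hadamardComp P Q)
    (TensorProduct.map (P.map (Equiv.sigmaCongrRight ε)) (Q.map (Equiv.sigmaCongrRight ε)))
    (fun i => TensorProduct.map (P.map (ε i)) (Q.map (ε i))) (hadamardComp P Q)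
    (span_tmul_range _ _) (fun i => span_tmul_range (P.obj (J i)) (Q.obj (J i))) ?_ a b
  intro a b
  simp only [hadamardComp_tmul, TensorProduct.map_tmul, P.map_inner, Q.map_inner]

theorem hadamardComp_outer (P : Operad.{u, v} k) (Q : Operad.{u, w} k) {I I' : Type} [Finite I]
    [Finite I'] {J : I' → Type} [∀ i, Finite (J i)] (e : I ≃ I')
    (a : P.obj I ⊗[k] Q.obj I) (b : ∀ i, P.obj (J i) ⊗[k] Q.obj (J i)) :
    TensorProduct.map (P.map (Equiv.sigmaCongrLeft e)) (Q.map (Equiv.sigmaCongrLeft e))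
      (hadamardComp P Q (J := fun i => J (e i)) a (fun i => b (e i))) =
      hadamardComp P Q (TensorProduct.map (P.map e) (Q.map e) a) b := by
  refine outer_of_span (M := fun i => P.obj (J i) ⊗[k] Q.obj (J i)) e
    (hadamardComp P Q (J := fun i => J (e i)))
    (TensorProduct.map (P.map (Equiv.sigmaCongrLeft e)) (Q.map (Equiv.sigmaCongrLeft e)))
    (TensorProduct.map (P.map e) (Q.map e)) (hadamardComp P Q)
    (span_tmul_range _ _) (fun i => span_tmul_range (P.obj (J i)) (Q.obj (J i))) ?_ a b
  intro a b
  have h1 := P.map_outer e a.1 (fun i => (b i).1)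
  have h2 := Q.map_outer e a.2 (fun i => (b i).2)
  simp only [hadamardComp_tmul, TensorProduct.map_tmul, h1, h2]

/-- The Hadamard product: componentwise tensor product with componentwise structure. -/
noncomputable def hadamard (P : Operad.{u, v} k) (Q : Operad.{u, w} k) :
    Operad.{u, max v w} k where
  obj I _ := P.obj I ⊗[k] Q.obj I
  map e := TensorProduct.map (P.map e) (Q.map e)
  one := P.one ⊗ₜ Q.one
  comp := hadamardComp P Q
  map_refl {I _} a := by
    have : TensorProduct.map (P.map (Equiv.refl I)) (Q.map (Equiv.refl I)) =
        LinearMap.id := by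
      ext; simp [P.map_refl, Q.map_refl]
    exact congrArg (fun t => t a) this
  map_trans e e' a := by
    have : TensorProduct.map (P.map (e.trans e')) (Q.map (e.trans e')) =
        TensorProduct.map (P.map e') (Q.map e') ∘ₗ TensorProduct.map (P.map e) (Q.map e) := by
      ext; simp [P.map_trans, Q.map_trans]
    exact congrArg (fun t => t a) this
  map_inner ε a b := hadamardComp_inner P Q ε a b
  map_outer e a b := hadamardComp_outer P Q e a b
  one_comp {I _} a := by
    induction a with
    | zero =>
      have : (fun _ : Unit => (0 : P.obj I ⊗[k] Q.obj I)) = 0 := rfl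
      rw [this, MultilinearMap.map_zero, map_zero]
    | tmul x y => simp [hadamardComp_tmul, P.one_comp, Q.one_comp]
    | add x y hx hy =>
      have h := (hadamardComp P Q (J := fun _ : Unit => I)
        (P.one ⊗ₜ[k] Q.one)).map_update_add (fun _ : Unit => x) () x y
      have h' : ∀ z, Function.update (fun _ : Unit => x) () z = fun _ => z := by
        intro z; funext i; simp
      rw [h', h', h'] at h
      rw [h, map_add, hx, hy]
  comp_one {I _} a := by
    induction a with
    | zero => simp
    | tmul x y => simp [hadamardComp_tmul, P.comp_one, Q.comp_one]
    | add x y hx hy => rw [map_add, _root_.add_apply, map_add, hx, hy]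
  assoc a b c := hadamardComp_assoc P Q a b c

theorem hadamard_comp_tmul (P : Operad.{u, v} k) (Q : Operad.{u, w} k) {I : Type} [Finite I]
    {J : I → Type} [∀ i, Finite (J i)] (a : P.obj I) (a' : Q.obj I) (b : ∀ i, P.obj (J i))
    (b' : ∀ i, Q.obj (J i)) :
    (hadamard P Q).comp (a ⊗ₜ[k] a' : P.obj I ⊗[k] Q.obj I)
        (fun i => (b i ⊗ₜ[k] b' i : P.obj (J i) ⊗[k] Q.obj (J i))) =
      (P.comp a b ⊗ₜ[k] Q.comp a' b' : P.obj (Σ i, J i) ⊗[k] Q.obj (Σ i, J i)) := by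
  exact hadamardComp_tmul P Q a a' b b'

/-- The morphism `f ⊗ g` of Hadamard products. -/
noncomputable def Hom.tensor {P P' Q Q' : Operad.{u, v} k} (f : Hom P P') (g : Hom Q Q') :
    Hom (hadamard P Q) (hadamard P' Q') where
  toFun I _ := TensorProduct.map (f.toFun I) (g.toFun I)
  map_map {I J _ _} e a := by
    have : TensorProduct.map (f.toFun J) (g.toFun J) ∘ₗ TensorProduct.map (P.map e) (Q.map e) =
        TensorProduct.map (P'.map e) (Q'.map e) ∘ₗ
          TensorProduct.map (f.toFun I) (g.toFun I) := by
      ext; simp [f.map_map, g.map_map]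
    exact congrArg (fun t => t a) this
  map_one := by
    change TensorProduct.map (f.toFun Unit) (g.toFun Unit) (P.one ⊗ₜ[k] Q.one) = P'.one ⊗ₜ[k] Q'.one
    simp [f.map_one, g.map_one]
  map_comp {I _ J _} a b := by
    refine inner_of_span (hadamardComp P Q)
      (TensorProduct.map (f.toFun (Σ i, J i)) (g.toFun (Σ i, J i)))
      (fun i => TensorProduct.map (f.toFun (J i)) (g.toFun (J i)))
      (hadamardComp P' Q' ∘ₗ
        TensorProduct.map (f.toFun I) (g.toFun I))
      (span_tmul_range _ _) (fun i => span_tmul_range _ _) ?_ a b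
    intro a b
    simp [hadamardComp_tmul, f.map_comp, g.map_comp]

/-! ### Ideals and quotients -/

/-- An operad ideal. -/
structure OpIdeal (P : Operad.{u, v} k) where
  carrier : ∀ (I : Type) [Finite I], Submodule k (P.obj I)
  map_mem : ∀ {I J : Type} [Finite I] [Finite J] (e : I ≃ J) (a : P.obj I),
    a ∈ carrier I → P.map e a ∈ carrier J
  comp_mem_left : ∀ {I : Type} [Finite I] {J : I → Type} [∀ i, Finite (J i)]
    (a : P.obj I) (b : ∀ i, P.obj (J i)), a ∈ carrier I → P.comp a b ∈ carrier (Σ i, J i)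
  comp_mem_right : ∀ {I : Type} [Finite I] {J : I → Type} [∀ i, Finite (J i)]
    (a : P.obj I) (b : ∀ i, P.obj (J i)) (i : I), b i ∈ carrier (J i) →
    P.comp a b ∈ carrier (Σ i, J i)

/-- The operad ideal generated by a family of sets of operations. -/
def OpIdeal.span {P : Operad.{u, v} k} (G : ∀ (I : Type) [Finite I], Set (P.obj I)) :
    OpIdeal P where
  carrier I _ := sInf {S | ∃ N : OpIdeal P,
    (∀ (J : Type) [Finite J], G J ⊆ (N.carrier J : Set (P.obj J))) ∧ S = N.carrier I}
  map_mem e a ha := by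
    simp only [Submodule.mem_sInf, Set.mem_ofPred_eq] at ha ⊢
    rintro _ ⟨N, hN, rfl⟩
    exact N.map_mem e a (ha _ ⟨N, hN, rfl⟩)
  comp_mem_left a b ha := by
    simp only [Submodule.mem_sInf, Set.mem_ofPred_eq] at ha ⊢
    rintro _ ⟨N, hN, rfl⟩
    exact N.comp_mem_left a b (ha _ ⟨N, hN, rfl⟩)
  comp_mem_right a b i hb := by
    simp only [Submodule.mem_sInf, Set.mem_ofPred_eq] at hb ⊢
    rintro _ ⟨N, hN, rfl⟩
    exact N.comp_mem_right a b i (hb _ ⟨N, hN, rfl⟩)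

theorem OpIdeal.comp_sub_mem {P : Operad.{u, v} k} (N : OpIdeal P) {I : Type} [Finite I]
    {J : I → Type} [∀ i, Finite (J i)] (a : P.obj I) (b b' : ∀ i, P.obj (J i))
    (h : ∀ i, b i - b' i ∈ N.carrier (J i)) :
    P.comp a b - P.comp a b' ∈ N.carrier (Σ i, J i) := by
  classical
  have := Fintype.ofFinite I
  suffices H : ∀ s : Finset I, P.comp a (s.piecewise b b') - P.comp a b' ∈
      N.carrier (Σ i, J i) by
    simpa using H Finset.univ
  intro s
  induction s using Finset.induction_on with
  | empty => simp
  | insert i s hi ih =>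
    have e : P.comp a ((insert i s).piecewise b b') - P.comp a (s.piecewise b b') =
        P.comp a (Function.update (s.piecewise b b') i (b i - b' i)) := by
      rw [MultilinearMap.map_update_sub, Finset.piecewise_insert]
      congr 2
      symm
      have : b' i = s.piecewise b b' i := by simp [hi]
      rw [this, Function.update_eq_self]
    have m : P.comp a (Function.update (s.piecewise b b') i (b i - b' i)) ∈
        N.carrier (Σ i, J i) := N.comp_mem_right a _ i (by simpa using h i)
    have := add_mem (e ▸ m) ih
    simpa using this

/-- Composition in the quotient, with the outer operation still in `P`. -/
noncomputable def OpIdeal.compAux {P : Operad.{u, v} k} (N : OpIdeal P) {I : Type} [Finite I]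
    {J : I → Type} [∀ i, Finite (J i)] (a : P.obj I) :
    MultilinearMap k (fun i => P.obj (J i) ⧸ N.carrier (J i))
      (P.obj (Σ i, J i) ⧸ N.carrier (Σ i, J i)) where
  toFun b := (N.carrier (Σ i, J i)).mkQ (P.comp a (fun i => Quotient.out (b i)))
  map_update_add' := by
    intro _ b i x y
    have key : ∀ (c c' : ∀ i, P.obj (J i)),
        (∀ i, (Submodule.Quotient.mk (c i) : P.obj (J i) ⧸ N.carrier (J i)) =
          Submodule.Quotient.mk (c' i)) →
        (N.carrier (Σ i, J i)).mkQ (P.comp a c) = (N.carrier (Σ i, J i)).mkQ (P.comp a c') := by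
      intro c c' h
      exact (Submodule.Quotient.eq _).2 (N.comp_sub_mem a c c'
        fun i => (Submodule.Quotient.eq _).1 (h i))
    have ho : ∀ {i} (z : P.obj (J i) ⧸ N.carrier (J i)),
        (Submodule.Quotient.mk (Quotient.out z) : P.obj (J i) ⧸ N.carrier (J i)) = z :=
      fun z => Quotient.out_eq _
    have hu : ∀ (z : P.obj (J i) ⧸ N.carrier (J i)) (z' : P.obj (J i)),
        Submodule.Quotient.mk z' = z →
        (N.carrier (Σ i, J i)).mkQ (P.comp a (fun i' => Quotient.out (Function.update b i z i'))) =
        (N.carrier (Σ i, J i)).mkQ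
          (P.comp a (Function.update (fun i' => Quotient.out (b i')) i z')) := by
      intro z z' hz
      refine key _ _ fun i' => ?_
      by_cases hi : i' = i
      · subst hi; simp only [Function.update_self]; rw [ho, hz]
      · simp only [Function.update_of_ne hi]
    rw [hu _ (Quotient.out x + Quotient.out y)
      (by rw [Submodule.Quotient.mk_add, ho, ho]), hu x _ (ho x), hu y _ (ho y),
      MultilinearMap.map_update_add, map_add]
  map_update_smul' := by
    intro _ b i r x
    have key : ∀ (c c' : ∀ i, P.obj (J i)),
        (∀ i, (Submodule.Quotient.mk (c i) : P.obj (J i) ⧸ N.carrier (J i)) =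
          Submodule.Quotient.mk (c' i)) →
        (N.carrier (Σ i, J i)).mkQ (P.comp a c) = (N.carrier (Σ i, J i)).mkQ (P.comp a c') := by
      intro c c' h
      exact (Submodule.Quotient.eq _).2 (N.comp_sub_mem a c c'
        fun i => (Submodule.Quotient.eq _).1 (h i))
    have ho : ∀ {i} (z : P.obj (J i) ⧸ N.carrier (J i)),
        (Submodule.Quotient.mk (Quotient.out z) : P.obj (J i) ⧸ N.carrier (J i)) = z :=
      fun z => Quotient.out_eq _
    have hu : ∀ (z : P.obj (J i) ⧸ N.carrier (J i)) (z' : P.obj (J i)),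
        Submodule.Quotient.mk z' = z →
        (N.carrier (Σ i, J i)).mkQ (P.comp a (fun i' => Quotient.out (Function.update b i z i'))) =
        (N.carrier (Σ i, J i)).mkQ
          (P.comp a (Function.update (fun i' => Quotient.out (b i')) i z')) := by
      intro z z' hz
      refine key _ _ fun i' => ?_
      by_cases hi : i' = i
      · subst hi; simp only [Function.update_self]; rw [ho, hz]
      · simp only [Function.update_of_ne hi]
    rw [hu _ (r • Quotient.out x) (by rw [Submodule.Quotient.mk_smul, ho]), hu x _ (ho x),
      MultilinearMap.map_update_smul, map_smul]

theorem OpIdeal.compAux_mk {P : Operad.{u, v} k} (N : OpIdeal P) {I : Type} [Finite I]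
    {J : I → Type} [∀ i, Finite (J i)] (a : P.obj I) (b : ∀ i, P.obj (J i)) :
    N.compAux a (fun i => (N.carrier (J i)).mkQ (b i)) =
      (N.carrier (Σ i, J i)).mkQ (P.comp a b) :=
  (Submodule.Quotient.eq _).2 (N.comp_sub_mem a _ b fun _ =>
    (Submodule.Quotient.eq _).1 (Quotient.out_eq _))

theorem OpIdeal.exists_rep {P : Operad.{u, v} k} (N : OpIdeal P) {I : Type}
    {J : I → Type} [∀ i, Finite (J i)] (b : ∀ i, P.obj (J i) ⧸ N.carrier (J i)) :
    ∃ b' : ∀ i, P.obj (J i), b = fun i => (N.carrier (J i)).mkQ (b' i) :=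
  ⟨fun i => Quotient.out (b i), funext fun i => (Quotient.out_eq (b i)).symm⟩

/-- Composition in the quotient. -/
noncomputable def OpIdeal.compQ {P : Operad.{u, v} k} (N : OpIdeal P) {I : Type} [Finite I]
    {J : I → Type} [∀ i, Finite (J i)] :
    (P.obj I ⧸ N.carrier I) →ₗ[k] MultilinearMap k (fun i => P.obj (J i) ⧸ N.carrier (J i))
      (P.obj (Σ i, J i) ⧸ N.carrier (Σ i, J i)) :=
  (N.carrier I).liftQ
    { toFun := fun a => N.compAux a
      map_add' := by
        intro a a'; ext b
        obtain ⟨b, rfl⟩ := N.exists_rep b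
        simp only [_root_.add_apply, N.compAux_mk, map_add]
      map_smul' := by
        intro r a; ext b
        obtain ⟨b, rfl⟩ := N.exists_rep b
        simp only [_root_.smul_apply, N.compAux_mk, map_smul, RingHom.id_apply] }
    (by
      intro a ha
      rw [LinearMap.mem_ker]
      ext b
      obtain ⟨b, rfl⟩ := N.exists_rep b
      change N.compAux a _ = 0
      rw [N.compAux_mk]
      exact (Submodule.Quotient.mk_eq_zero _).2 (N.comp_mem_left a b ha))

theorem OpIdeal.compQ_mk {P : Operad.{u, v} k} (N : OpIdeal P) {I : Type} [Finite I]
    {J : I → Type} [∀ i, Finite (J i)] (a : P.obj I) (b : ∀ i, P.obj (J i)) :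
    N.compQ ((N.carrier I).mkQ a) (fun i => (N.carrier (J i)).mkQ (b i)) =
      (N.carrier (Σ i, J i)).mkQ (P.comp a b) :=
  N.compAux_mk a b

/-- The quotient of an operad by an ideal. -/
noncomputable def quotient (P : Operad.{u, v} k) (N : OpIdeal P) : Operad.{u, v} k where
  obj I _ := P.obj I ⧸ N.carrier I
  map {I J _ _} e := (N.carrier I).mapQ (N.carrier J) (P.map e) (fun a ha => N.map_mem e a ha)
  one := (N.carrier Unit).mkQ P.one
  comp := N.compQ
  map_refl a := by
    obtain ⟨a, rfl⟩ := Submodule.mkQ_surjective _ a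
    simp [P.map_refl]
  map_trans e e' a := by
    obtain ⟨a, rfl⟩ := Submodule.mkQ_surjective _ a
    simp [P.map_trans]
  map_inner ε a b := by
    obtain ⟨a, rfl⟩ := Submodule.mkQ_surjective _ a
    obtain ⟨b, rfl⟩ := N.exists_rep b
    rw [N.compQ_mk]
    exact (congrArg _ (P.map_inner ε a b)).trans (N.compQ_mk _ _).symm
  map_outer e a b := by
    obtain ⟨a, rfl⟩ := Submodule.mkQ_surjective _ a
    obtain ⟨b, rfl⟩ := N.exists_rep b
    rw [N.compQ_mk]
    exact (congrArg _ (P.map_outer e a b)).trans (N.compQ_mk _ _).symm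
  one_comp a := by
    obtain ⟨a, rfl⟩ := Submodule.mkQ_surjective _ a
    rw [N.compQ_mk]
    exact congrArg _ (P.one_comp a)
  comp_one a := by
    obtain ⟨a, rfl⟩ := Submodule.mkQ_surjective _ a
    rw [N.compQ_mk]
    exact congrArg _ (P.comp_one a)
  assoc a b c := by
    obtain ⟨a, rfl⟩ := Submodule.mkQ_surjective _ a
    obtain ⟨b, rfl⟩ := N.exists_rep b
    obtain ⟨c, rfl⟩ := N.exists_rep c
    simp only [N.compQ_mk]
    exact congrArg _ (P.assoc a b c)

/-- The quotient morphism. -/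
noncomputable def quotientMk (P : Operad.{u, v} k) (N : OpIdeal P) : Hom P (P.quotient N) where
  toFun I _ := (N.carrier I).mkQ
  map_map _ _ := rfl
  map_one := rfl
  map_comp a b := (N.compQ_mk a b).symm

/-! ### Linearization of operads in sets -/

end Operad

/-- A symmetric operad in sets, on finite sets of inputs. -/
structure SetOperad where
  obj : (I : Type) → [Finite I] → Type v
  map : ∀ {I J : Type} [Finite I] [Finite J], I ≃ J → obj I → obj J
  one : obj Unit
  comp : ∀ {I : Type} [Finite I] {J : I → Type} [∀ i, Finite (J i)],
    obj I → (∀ i, obj (J i)) → obj (Σ i, J i)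
  map_refl : ∀ {I : Type} [Finite I] (a : obj I), map (Equiv.refl I) a = a
  map_trans : ∀ {I J K : Type} [Finite I] [Finite J] [Finite K] (e : I ≃ J) (e' : J ≃ K)
    (a : obj I), map (e.trans e') a = map e' (map e a)
  map_inner : ∀ {I : Type} [Finite I] {J J' : I → Type} [∀ i, Finite (J i)] [∀ i, Finite (J' i)]
    (ε : ∀ i, J i ≃ J' i) (a : obj I) (b : ∀ i, obj (J i)),
    map (Equiv.sigmaCongrRight ε) (comp a b) = comp a (fun i => map (ε i) (b i))
  map_outer : ∀ {I I' : Type} [Finite I] [Finite I'] {J : I' → Type} [∀ i, Finite (J i)]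
    (e : I ≃ I') (a : obj I) (b : ∀ i, obj (J i)),
    map (Equiv.sigmaCongrLeft e) (comp a (fun i => b (e i))) = comp (map e a) b
  one_comp : ∀ {I : Type} [Finite I] (a : obj I),
    map (Equiv.uniqueSigma fun _ : Unit => I) (comp one (fun _ => a)) = a
  comp_one : ∀ {I : Type} [Finite I] (a : obj I),
    map (Equiv.sigmaUnique I fun _ => Unit) (comp a (fun _ => one)) = a
  assoc : ∀ {I : Type} [Finite I] {J : I → Type} [∀ i, Finite (J i)]
    {L : ∀ i, J i → Type} [∀ i j, Finite (L i j)]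
    (a : obj I) (b : ∀ i, obj (J i)) (c : ∀ p : Σ i, J i, obj (L p.1 p.2)),
    map (Equiv.sigmaAssoc L) (comp (comp a b) c) =
      comp a (fun i => comp (b i) (fun j => c ⟨i, j⟩))

theorem span_single_range (k : Type u) [Field k] (T : Type*) :
    Submodule.span k (Set.range fun t : T => Finsupp.single t (1 : k)) = ⊤ := by
  rw [← (Finsupp.basisSingleOne : Module.Basis T k (T →₀ k)).span_eq]
  simp

theorem linearize_assoc (k : Type u) [Field k] (T : SetOperad.{v}) {I : Type} [Finite I]
    {J : I → Type} [∀ i, Finite (J i)] {L : ∀ i, J i → Type} [∀ i j, Finite (L i j)]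
    (a : T.obj I →₀ k) (b : ∀ i, T.obj (J i) →₀ k)
    (c : ∀ p : Σ i, J i, T.obj (L p.1 p.2) →₀ k) :
    Finsupp.lmapDomain k k (T.map (Equiv.sigmaAssoc L))
      (basisComp (T.comp (J := fun p : Σ i, J i => L p.1 p.2)) (basisComp T.comp a b) c) =
      basisComp (T.comp (J := fun i => Σ j, L i j)) a
        (fun i => basisComp (T.comp (J := L i)) (b i) (fun j => c ⟨i, j⟩)) := by
  refine assoc_of_span (M := fun i => T.obj (J i) →₀ k) (N := fun i j => T.obj (L i j) →₀ k)
    (W := fun i => T.obj (Σ j, L i j) →₀ k) (basisComp T.comp)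
    (basisComp (T.comp (J := fun p : Σ i, J i => L p.1 p.2)))
    (Finsupp.lmapDomain k k (T.map (Equiv.sigmaAssoc L)))
    (fun i => basisComp (T.comp (J := L i)))
    (basisComp (T.comp (J := fun i => Σ j, L i j)))
    (span_single_range k _) (fun i => span_single_range k (T.obj (J i)))
    (fun i j => span_single_range k (T.obj (L i j))) ?_ a b c
  intro a b c
  have h := T.assoc a b (fun p => c p.1 p.2)
  simp only [basisComp_single]
  simpa using congrArg (fun t => Finsupp.single t (1 : k)) h

theorem linearize_inner (k : Type u) [Field k] (T : SetOperad.{v}) {I : Type} [Finite I]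
    {J J' : I → Type} [∀ i, Finite (J i)] [∀ i, Finite (J' i)] (ε : ∀ i, J i ≃ J' i)
    (a : T.obj I →₀ k) (b : ∀ i, T.obj (J i) →₀ k) :
    Finsupp.lmapDomain k k (T.map (Equiv.sigmaCongrRight ε)) (basisComp T.comp a b) =
      basisComp T.comp a (fun i => Finsupp.lmapDomain k k (T.map (ε i)) (b i)) := by
  refine inner_of_span (M := fun i => T.obj (J i) →₀ k) (W := fun i => T.obj (J' i) →₀ k)
    (basisComp T.comp) (Finsupp.lmapDomain k k (T.map (Equiv.sigmaCongrRight ε)))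
    (fun i => Finsupp.lmapDomain k k (T.map (ε i))) (basisComp T.comp)
    (span_single_range k _) (fun i => span_single_range k (T.obj (J i))) ?_ a b
  intro a b
  simp [basisComp_single, T.map_inner]

theorem linearize_outer (k : Type u) [Field k] (T : SetOperad.{v}) {I I' : Type} [Finite I]
    [Finite I'] {J : I' → Type} [∀ i, Finite (J i)] (e : I ≃ I')
    (a : T.obj I →₀ k) (b : ∀ i, T.obj (J i) →₀ k) :
    Finsupp.lmapDomain k k (T.map (Equiv.sigmaCongrLeft e))
      (basisComp (T.comp (J := fun i => J (e i))) a (fun i => b (e i))) =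
      basisComp T.comp (Finsupp.lmapDomain k k (T.map e) a) b := by
  refine outer_of_span (M := fun i => T.obj (J i) →₀ k) e
    (basisComp (T.comp (J := fun i => J (e i))))
    (Finsupp.lmapDomain k k (T.map (Equiv.sigmaCongrLeft e)))
    (Finsupp.lmapDomain k k (T.map e)) (basisComp T.comp)
    (span_single_range k _) (fun i => span_single_range k (T.obj (J i))) ?_ a b
  intro a b
  have h := basisComp_single (k := k) (T.comp (J := fun i => J (e i))) a (fun i => b (e i))
  rw [h]
  simp [basisComp_single, T.map_outer]

/-- The `k`-linear operad spanned by an operad in sets. -/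
noncomputable def SetOperad.linearize (k : Type u) [Field k] (T : SetOperad.{v}) :
    Operad.{u, max u v} k where
  obj I _ := T.obj I →₀ k
  map e := Finsupp.lmapDomain k k (T.map e)
  one := Finsupp.single T.one 1
  comp := basisComp T.comp
  map_refl {I _} a := by
    have : T.map (Equiv.refl I) = id := funext T.map_refl
    simp [this]
  map_trans e e' a := by
    have : T.map (e.trans e') = T.map e' ∘ T.map e := funext (T.map_trans e e')
    simp [this, Finsupp.mapDomain_comp]
  map_inner ε a b := linearize_inner k T ε a b
  map_outer e a b := linearize_outer k T e a b
  one_comp {I _} a := by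
    induction a using Finsupp.induction_linear with
    | zero =>
      have : (fun _ : Unit => (0 : T.obj I →₀ k)) = 0 := rfl
      rw [this, MultilinearMap.map_zero, map_zero]
    | single x r =>
      have h := (basisComp (k := k) T.comp
        (Finsupp.single T.one 1)).map_update_smul (fun _ : Unit => Finsupp.single x 1) () r
          (Finsupp.single x 1)
      have h' : ∀ z, Function.update (fun _ : Unit => Finsupp.single x (1 : k)) () z =
          fun _ => z := by
        intro z; funext i; simp
      rw [h', h', basisComp_single] at h
      simp only [Finsupp.smul_single, smul_eq_mul, mul_one] at h
      rw [h]
      simp [T.one_comp]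
    | add x y hx hy =>
      have h := (basisComp (k := k) T.comp
        (Finsupp.single T.one 1)).map_update_add (fun _ : Unit => x) () x y
      have h' : ∀ z, Function.update (fun _ : Unit => x) () z = fun _ => z := by
        intro z; funext i; simp
      rw [h', h', h'] at h
      rw [h, map_add, hx, hy]
  comp_one {I _} a := by
    induction a using Finsupp.induction_linear with
    | zero => simp
    | single x r =>
      have : Finsupp.single x r = r • Finsupp.single x (1 : k) := by simp
      rw [this, map_smul, _root_.smul_apply, basisComp_single]
      simp [T.comp_one]
    | add x y hx hy => rw [map_add, _root_.add_apply, map_add, hx, hy]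
  assoc a b c := linearize_assoc k T a b c

/-! ### Free operads and the operad `Perm` -/

/-- A language: operation symbols with arities, all at least two. -/
structure Signature where
  ops : Type u
  arity : ops → ℕ
  two_le : ∀ f, 2 ≤ arity f

/-- Terms in the language `Ω` with variables from `X`. -/
inductive Term (Ω : Signature.{u}) (X : Type) : Type u
  | var (x : X) : Term Ω X
  | op (f : Ω.ops) (ts : Fin (Ω.arity f) → Term Ω X) : Term Ω X

namespace Term

variable {Ω : Signature.{u}} {X Y Z : Type}

/-- Simultaneous substitution of terms for variables. -/
def bind : Term Ω X → (X → Term Ω Y) → Term Ω Y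
  | var x, g => g x
  | op f ts, g => op f (fun i => (ts i).bind g)

/-- Renaming of variables. -/
def rename (g : X → Y) : Term Ω X → Term Ω Y
  | var x => var (g x)
  | op f ts => op f (fun i => (ts i).rename g)

open Classical in
/-- The number of occurrences of the variable `x`. -/
noncomputable def count : Term Ω X → X → ℕ
  | var y, x => if y = x then 1 else 0
  | op _ ts, x => ∑ i, (ts i).count x

/-- A term is polylinear if every variable occurs in it exactly once. -/
def Polylinear (t : Term Ω X) : Prop := ∀ x, t.count x = 1

/-- The value of a term in an algebra with operations `F`. -/
def eval {A : Type v} (F : ∀ f : Ω.ops, (Fin (Ω.arity f) → A) → A) (a : X → A) : Term Ω X → A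
  | var x => a x
  | op f ts => F f (fun i => (ts i).eval F a)

theorem rename_eq_bind (g : X → Y) (t : Term Ω X) : t.rename g = t.bind (fun x => var (g x)) := by
  induction t with
  | var x => rfl
  | op f ts ih => simp [rename, bind, ih]

theorem bind_bind (t : Term Ω X) (g : X → Term Ω Y) (h : Y → Term Ω Z) :
    (t.bind g).bind h = t.bind (fun x => (g x).bind h) := by
  induction t with
  | var x => rfl
  | op f ts ih => simp [bind, ih]

theorem bind_var (t : Term Ω X) : t.bind var = t := by
  induction t with
  | var x => rfl
  | op f ts ih => simp [bind, ih]

theorem count_rename_of_injective {g : X → Y} (hg : Function.Injective g) (t : Term Ω X) (x : X) :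
    (t.rename g).count (g x) = t.count x := by
  induction t with
  | var y =>
    by_cases h : y = x
    · simp [rename, count, h]
    · simp [rename, count, h, hg.ne h]
  | op f ts ih => simp [rename, count, ih]

theorem count_rename_of_notMem {g : X → Y} (t : Term Ω X) (y : Y) (hy : ∀ x, g x ≠ y) :
    (t.rename g).count y = 0 := by
  induction t with
  | var x => simp [rename, count, hy x]
  | op f ts ih => simp [rename, count, ih]

theorem count_graft {J : X → Type} (t : Term Ω X) (s : ∀ x, Term Ω (J x)) (x : X) (j : J x) :
    (t.bind (fun x => (s x).rename (Sigma.mk x))).count ⟨x, j⟩ = t.count x * (s x).count j := by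
  classical
  induction t with
  | var y =>
    by_cases h : y = x
    · subst h
      simp [bind, count, count_rename_of_injective sigma_mk_injective]
    · simp only [bind, count, h, if_false, zero_mul]
      refine count_rename_of_notMem _ _ fun z hz => h ?_
      exact congrArg Sigma.fst hz
  | op f ts ih => simp [bind, count, ih, Finset.sum_mul]

theorem Polylinear.rename {t : Term Ω X} (ht : t.Polylinear) (e : X ≃ Y) :
    (t.rename e).Polylinear := by
  intro y
  obtain ⟨x, rfl⟩ := e.surjective y
  rw [count_rename_of_injective e.injective, ht x]

theorem Polylinear.graft {J : X → Type} {t : Term Ω X} (ht : t.Polylinear)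
    {s : ∀ x, Term Ω (J x)} (hs : ∀ x, (s x).Polylinear) :
    (t.bind (fun x => (s x).rename (Sigma.mk x))).Polylinear := by
  rintro ⟨x, j⟩
  rw [count_graft, ht x, hs x j]

end Term

/-- The operad in sets of polylinear terms; `comp` substitutes the terms `b i`, with variables
kept apart, into the term `a`. -/
def termOperad (Ω : Signature.{u}) : SetOperad.{u} where
  obj I _ := {t : Term Ω I // t.Polylinear}
  map e t := ⟨t.1.rename e, t.2.rename e⟩
  one := ⟨Term.var (), fun x => by simp [Term.count]⟩
  comp a b := ⟨a.1.bind (fun i => (b i).1.rename (Sigma.mk i)), a.2.graft fun i => (b i).2⟩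
  map_refl a := Subtype.ext (by simp [Term.rename_eq_bind, Term.bind_var])
  map_trans e e' a := Subtype.ext (by simp [Term.rename_eq_bind, Term.bind_bind, Term.bind])
  map_inner ε a b := Subtype.ext (by simp [Term.rename_eq_bind, Term.bind_bind, Term.bind])
  map_outer e a b := Subtype.ext (by
    simp only [Term.rename_eq_bind, Term.bind_bind, Term.bind]
    rfl)
  one_comp a := Subtype.ext (by
    simp only [Term.rename_eq_bind, Term.bind_bind, Term.bind]
    exact Term.bind_var a.1)
  comp_one a := Subtype.ext (by
    simp only [Term.rename_eq_bind, Term.bind_bind, Term.bind]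
    exact Term.bind_var a.1)
  assoc a b c := Subtype.ext (by
    simp only [Term.rename_eq_bind, Term.bind_bind, Term.bind]
    rfl)

/-- The free operad generated by the language `Ω`: `(Free k Ω).obj (Fin n)` is the space of
polylinear polynomials of type `Ω` in `n` variables. -/
noncomputable def Free (k : Type u) [Field k] (Ω : Signature.{u}) : Operad.{u, u} k :=
  (termOperad Ω).linearize k

/-- A polylinear monomial as an element of the free operad. -/
noncomputable def mono (k : Type u) [Field k] {Ω : Signature.{u}} {I : Type} [Finite I]
    (t : Term Ω I) (ht : t.Polylinear) : (Free k Ω).obj I :=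
  (Finsupp.single (⟨t, ht⟩ : {t : Term Ω I // t.Polylinear}) 1 :
    {t : Term Ω I // t.Polylinear} →₀ k)

theorem map_mono (k : Type u) [Field k] {Ω : Signature.{u}} {I J : Type} [Finite I] [Finite J]
    (e : I ≃ J) (t : Term Ω I) (ht : t.Polylinear) :
    (Free k Ω).map e (mono k t ht) = mono k (t.rename e) (ht.rename e) :=
  Finsupp.mapDomain_single

theorem comp_mono (k : Type u) [Field k] {Ω : Signature.{u}} {I : Type} [Finite I]
    {J : I → Type} [∀ i, Finite (J i)] (t : Term Ω I) (ht : t.Polylinear)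
    (s : ∀ i, Term Ω (J i)) (hs : ∀ i, (s i).Polylinear) :
    (Free k Ω).comp (mono k t ht) (fun i => mono k (s i) (hs i)) =
      mono k (t.bind (fun i => (s i).rename (Sigma.mk i))) (ht.graft hs) :=
  basisComp_single (termOperad Ω).comp ⟨t, ht⟩ (fun i => ⟨s i, hs i⟩)

theorem mono_congr (k : Type u) [Field k] {Ω : Signature.{u}} {I : Type} [Finite I]
    {t s : Term Ω I} (h : t = s) (ht : t.Polylinear) (hs : s.Polylinear) :
    mono k t ht = mono k s hs := by
  subst h; rfl

/-- The operad in sets with `obj I = I` and `k(j_1, …, j_n) = (k, j_k)`. -/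
def permSet : SetOperad.{0} where
  obj I _ := I
  map e := e
  one := ()
  comp a b := ⟨a, b a⟩
  map_refl _ := rfl
  map_trans _ _ _ := rfl
  map_inner _ _ _ := rfl
  map_outer _ _ _ := rfl
  one_comp _ := rfl
  comp_one _ := rfl
  assoc _ _ _ := rfl

/-- The operad `Perm`: `Perm(n)` is `k^n` with standard basis `e_i = Finsupp.single i 1`. -/
noncomputable def PermOperad (k : Type u) [Field k] : Operad.{u, u} k :=
  permSet.linearize k

/-- The basis vector `e_i` of `Perm`. -/
noncomputable def permE (k : Type u) [Field k] {I : Type} [Finite I] (i : I) :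
    (PermOperad k).obj I :=
  (Finsupp.single i 1 : I →₀ k)

theorem map_permE (k : Type u) [Field k] {I J : Type} [Finite I] [Finite J] (e : I ≃ J) (i : I) :
    (PermOperad k).map e (permE k i) = permE k (e i) :=
  Finsupp.mapDomain_single

theorem comp_permE (k : Type u) [Field k] {I : Type} [Finite I] {J : I → Type}
    [∀ i, Finite (J i)] (i : I) (j : ∀ i, J i) :
    (PermOperad k).comp (permE k i) (fun i => permE k (j i)) =
      permE k (⟨i, j i⟩ : Σ i, J i) :=
  basisComp_single permSet.comp i j

section

variable {k : Type u} [Field k]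

/-- The dialgebra operad `P ⊗ Perm`. -/
noncomputable def di (P : Operad.{u, u} k) : Operad.{u, u} k := P.hadamard (PermOperad k)

/-- The morphism `f ⊗ id` of dialgebra operads. -/
noncomputable def diMap {P Q : Operad.{u, u} k} (f : Operad.Hom P Q) : Operad.Hom (di P) (di Q) :=
  f.tensor (Operad.Hom.id (PermOperad k))

/-! ### Algebras, special algebras, and the operad of special identities -/

/-- An element of the endomorphism operad, as a multilinear map. -/
def endoEval {A : Type v} [AddCommGroup A] [Module k A] {I : Type} [Finite I]
    (f : (Operad.endo k A).obj I) : MultilinearMap k (fun _ : I => A) A := f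

/-- An algebra over an operad. -/
structure Alg (P : Operad.{u, u} k) where
  carrier : Type u
  [grp : AddCommGroup carrier]
  [mod : Module k carrier]
  str : Operad.Hom P (Operad.endo k carrier)

attribute [instance] Alg.grp Alg.mod

namespace Alg

/-- The value of the operation `f` at arguments `a`. -/
def act {P : Operad.{u, u} k} (A : Alg P) {I : Type} [Finite I] (f : P.obj I)
    (a : I → A.carrier) : A.carrier :=
  endoEval (A.str.toFun I f) a

/-- Homomorphisms of algebras. -/
def IsHom {P : Operad.{u, u} k} (A B : Alg P) (φ : A.carrier →ₗ[k] B.carrier) : Prop :=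
  ∀ (I : Type) [Finite I] (f : P.obj I) (a : I → A.carrier),
    φ (A.act f a) = B.act f (fun i => φ (a i))

/-- The polylinear identity `f = 0` holds on `A`. -/
def Satisfies {P : Operad.{u, u} k} (A : Alg P) {I : Type} [Finite I] (f : P.obj I) : Prop :=
  ∀ a : I → A.carrier, A.act f a = 0

/-- The `P`-algebra `A` is `ω`-special: its structure morphism is the composition of
`ω : P → R` with an `R`-algebra structure on the same space. -/
def IsSpecial {P R : Operad.{u, u} k} (ω : Operad.Hom P R) (A : Alg P) : Prop :=
  ∃ β : Operad.Hom R (Operad.endo k A.carrier), A.str = β.comp ω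

/-- Membership in the variety of all homomorphic images of subalgebras of `ω`-special algebras. -/
def InSpecialVariety {P R : Operad.{u, u} k} (ω : Operad.Hom P R) (A : Alg P) : Prop :=
  ∃ (B B₁ : Alg P) (ι : B₁.carrier →ₗ[k] B.carrier) (φ : B₁.carrier →ₗ[k] A.carrier),
    B.IsSpecial ω ∧ B₁.IsHom B ι ∧ Function.Injective ι ∧
      B₁.IsHom A φ ∧ Function.Surjective φ

end Alg

/-- The operad ideal of all polylinear identities that hold on a class of algebras. -/
def identities {P : Operad.{u, u} k} (C : Alg P → Prop) : Operad.OpIdeal P where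
  carrier I _ :=
    { carrier := {f | ∀ A : Alg P, C A → A.Satisfies f}
      add_mem' := by
        intro f g hf hg A hA a
        have h : A.act (f + g) a = A.act f a + A.act g a := by
          unfold Alg.act; rw [map_add]; rfl
        rw [h, hf A hA a, hg A hA a, add_zero]
      zero_mem' := by
        intro A _ a
        unfold Alg.act; rw [map_zero]; rfl
      smul_mem' := by
        intro c f hf A hA a
        have h : A.act (c • f) a = c • A.act f a := by
          unfold Alg.act; rw [map_smul]; rfl
        rw [h, hf A hA a, smul_zero] }
  map_mem e f hf A hA a := by
    unfold Alg.act
    rw [A.str.map_map]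
    exact hf A hA (fun i => a (e i))
  comp_mem_left f g hf A hA a := by
    unfold Alg.act
    rw [A.str.map_comp]
    exact hf A hA (fun i => A.act (g i) (fun j => a ⟨i, j⟩))
  comp_mem_right {I _ J _} f g i hg A hA a := by
    have h : A.act (P.comp f g) a = A.act f (fun i => A.act (g i) (fun j => a ⟨i, j⟩)) := by
      unfold Alg.act; rw [A.str.map_comp]; rfl
    rw [h]
    exact (endoEval (A.str.toFun I f)).map_coord_zero i (hg A hA (fun j => a ⟨i, j⟩))

/-- The operad `S^ω P`: the quotient of `P` by all polylinear identities that hold on the variety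
generated by `ω`-special `P`-algebras. -/
noncomputable def specialOperad {P R : Operad.{u, u} k} (ω : Operad.Hom P R) : Operad.{u, u} k :=
  P.quotient (identities (Alg.InSpecialVariety ω))

/-- The quotient morphism `S^ω : P → S^ω P`. -/
noncomputable def specialMk {P R : Operad.{u, u} k} (ω : Operad.Hom P R) :
    Operad.Hom P (specialOperad ω) :=
  P.quotientMk (identities (Alg.InSpecialVariety ω))

end

/-! ### Polynomials of type `Ω^(2)` as dialgebra polynomials -/

/-- The language `Ω^(2)`: for each `n`-ary `f` in `Ω` it has `n`-ary symbols `f^1, …, f^n`. -/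
def Signature.double (Ω : Signature.{u}) : Signature.{u} where
  ops := Σ f : Ω.ops, Fin (Ω.arity f)
  arity p := Ω.arity p.1
  two_le p := Ω.two_le p.1

namespace Term

variable {Ω : Signature.{u}} {X Y : Type}

/-- Forget the superscripts. -/
def forget : Term Ω.double X → Term Ω X
  | var x => var x
  | op p ts => op p.1 (fun i => (ts i).forget)

/-- The leaf reached from the root by following the superscripts. -/
def emph : Term Ω.double X → X
  | var x => x
  | op p ts => (ts p.2).emph

theorem count_forget (t : Term Ω.double X) (x : X) : t.forget.count x = t.count x := by
  induction t with
  | var y => rfl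
  | op p ts ih =>
    simp only [forget, count]
    exact Finset.sum_congr rfl fun i _ => ih i

theorem forget_bind (t : Term Ω.double X) (g : X → Term Ω.double Y) :
    (t.bind g).forget = t.forget.bind (fun x => (g x).forget) := by
  induction t with
  | var y => rfl
  | op p ts ih =>
    simp only [forget, bind]
    exact congrArg _ (funext fun i => ih i)

theorem emph_bind (t : Term Ω.double X) (g : X → Term Ω.double Y) :
    (t.bind g).emph = (g t.emph).emph := by
  induction t with
  | var y => rfl
  | op p ts ih =>
    simp only [emph, bind]
    exact ih p.2

theorem forget_rename (t : Term Ω.double X) (g : X → Y) :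
    (t.rename g).forget = t.forget.rename g := by
  simp only [rename_eq_bind, forget_bind, forget]

theorem emph_rename (t : Term Ω.double X) (g : X → Y) : (t.rename g).emph = g t.emph := by
  simp only [rename_eq_bind, emph_bind, emph]

open Classical in
/-- The term with superscripts attached to a term with emphasized leaf `x`: a symbol gets as
superscript the number of its branch that contains `x`, or the first number if there is none. -/
noncomputable def dot (x : X) : Term Ω X → Term Ω.double X
  | var y => var y
  | op f ts => op (Ω := Ω.double)
      ⟨f, if h : ∃ j, (ts j).count x ≠ 0 then h.choose
        else ⟨0, lt_of_lt_of_le Nat.zero_lt_two (Ω.two_le f)⟩⟩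
      (fun i => (ts i).dot x)

theorem forget_dot (x : X) (t : Term Ω X) : (t.dot x).forget = t := by
  induction t with
  | var y => rfl
  | op f ts ih => simp only [forget, dot, ih]

theorem Polylinear.dot {t : Term Ω X} (ht : t.Polylinear) (x : X) : (t.dot x).Polylinear := by
  intro y
  rw [← count_forget, forget_dot, ht y]

end Term

section

variable {k : Type u} [Field k]

theorem Term.Polylinear.forget {Ω : Signature.{u}} {X : Type} {t : Term Ω.double X}
    (ht : t.Polylinear) : t.forget.Polylinear := fun x => by rw [Term.count_forget, ht x]

/-- The map which sends a monomial with superscripts to `t ⊗ e_x`, where `t` is the monomial without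
superscripts and `x` is its emphasized leaf. -/
noncomputable def zetaLin (k : Type u) [Field k] (Ω : Signature.{u}) (I : Type) [Finite I] :
    ({t : Term Ω.double I // t.Polylinear} →₀ k) →ₗ[k]
      (Free k Ω).obj I ⊗[k] (PermOperad k).obj I :=
  Finsupp.lift _ k _ (fun t => mono k t.1.forget t.2.forget ⊗ₜ[k] permE k t.1.emph)

theorem zetaLin_single (Ω : Signature.{u}) (I : Type) [Finite I]
    (t : {t : Term Ω.double I // t.Polylinear}) :
    zetaLin k Ω I (Finsupp.single t 1) =
      mono k t.1.forget t.2.forget ⊗ₜ[k] permE k t.1.emph := by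
  simp [zetaLin]

theorem zetaLin_map (Ω : Signature.{u}) {I J : Type} [Finite I] [Finite J] (e : I ≃ J)
    (a : {t : Term Ω.double I // t.Polylinear} →₀ k) :
    zetaLin k Ω J (Finsupp.lmapDomain k k (fun t : {t : Term Ω.double I // t.Polylinear} =>
        (⟨t.1.rename e, t.2.rename e⟩ : {t : Term Ω.double J // t.Polylinear})) a) =
      TensorProduct.map ((Free k Ω).map e) ((PermOperad k).map e) (zetaLin k Ω I a) := by
  induction a using Finsupp.induction_linear with
  | zero => simp
  | add x y hx hy => simp only [map_add, hx, hy]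
  | single x r =>
    have hr : Finsupp.single x r = r • Finsupp.single x (1 : k) := by simp
    rw [hr]
    simp only [map_smul]
    refine congrArg (fun z => r • z) ?_
    rw [Finsupp.lmapDomain_apply, Finsupp.mapDomain_single, zetaLin_single, zetaLin_single,
      TensorProduct.map_tmul, map_mono, map_permE]
    exact congrArg₂ (fun x y => x ⊗ₜ[k] y) (mono_congr k (Term.forget_rename x.1 e) _ _)
      (congrArg (permE k) (Term.emph_rename x.1 e))

theorem zetaLin_comp (Ω : Signature.{u}) {I : Type} [Finite I] {J : I → Type}
    [∀ i, Finite (J i)] (a : {t : Term Ω.double I // t.Polylinear} →₀ k)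
    (b : ∀ i, {t : Term Ω.double (J i) // t.Polylinear} →₀ k) :
    zetaLin k Ω (Σ i, J i) (basisComp ((termOperad Ω.double).comp (J := J)) a b) =
      Operad.hadamardComp (Free k Ω) (PermOperad k) (zetaLin k Ω I a)
        (fun i => zetaLin k Ω (J i) (b i)) := by
  refine inner_of_span (M := fun i => {t : Term Ω.double (J i) // t.Polylinear} →₀ k)
    (W := fun i => (Free k Ω).obj (J i) ⊗[k] (PermOperad k).obj (J i))
    (basisComp ((termOperad Ω.double).comp (J := J))) (zetaLin k Ω (Σ i, J i))
    (fun i => zetaLin k Ω (J i))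
    (Operad.hadamardComp (Free k Ω) (PermOperad k) ∘ₗ zetaLin k Ω I)
    (span_single_range k _)
    (fun i => span_single_range k {t : Term Ω.double (J i) // t.Polylinear}) ?_ a b
  intro a b
  have h1 := basisComp_single (k := k) ((termOperad Ω.double).comp (J := J)) a b
  refine (congrArg (zetaLin k Ω (Σ i, J i)) h1).trans ?_
  refine (zetaLin_single Ω (Σ i, J i) ⟨a.1.bind (fun i => (b i).1.rename (Sigma.mk i)),
    a.2.graft fun i => (b i).2⟩).trans ?_
  change _ = Operad.hadamardComp (Free k Ω) (PermOperad k) (zetaLin k Ω I (Finsupp.single a 1))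
    (fun i => zetaLin k Ω (J i) (Finsupp.single (b i) 1))
  have h2 : (fun i => zetaLin k Ω (J i) (Finsupp.single (b i) 1)) = fun i =>
      mono k (b i).1.forget (b i).2.forget ⊗ₜ[k] permE k (b i).1.emph :=
    funext fun i => zetaLin_single Ω (J i) (b i)
  have h3 : zetaLin k Ω I (Finsupp.single a 1) =
      mono k a.1.forget a.2.forget ⊗ₜ[k] permE k a.1.emph := zetaLin_single Ω I a
  refine Eq.trans ?_ (congrArg₂ (fun x y => Operad.hadamardComp (Free k Ω) (PermOperad k) x y)
    h3 h2).symm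
  refine Eq.trans ?_ (Operad.hadamardComp_tmul (Free k Ω) (PermOperad k) _ _ _ _).symm
  refine Eq.trans ?_ (congrArg₂ (fun x y => x ⊗ₜ[k] y)
    (comp_mono k a.1.forget a.2.forget (fun i => (b i).1.forget) (fun i => (b i).2.forget))
    (comp_permE k a.1.emph (fun i => (b i).1.emph))).symm
  refine congrArg₂ (fun x y => x ⊗ₜ[k] y) (mono_congr k ?_ _ _) (congrArg (permE k) ?_)
  · simp only [Term.forget_bind, Term.forget_rename]
  · simp only [Term.emph_bind, Term.emph_rename]

/-- The morphism `ζ` from the free operad of the language `Ω^(2)` to `F_Ω ⊗ Perm` which maps the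
generator `f^i` to `f ⊗ e_i`. -/
noncomputable def zeta (k : Type u) [Field k] (Ω : Signature.{u}) :
    Operad.Hom (Free k Ω.double) (di (Free k Ω)) where
  toFun I _ := zetaLin k Ω I
  map_map e a := zetaLin_map Ω e a
  map_one := zetaLin_single Ω Unit ((termOperad Ω.double).one)
  map_comp a b := zetaLin_comp Ω a b

theorem Term.polylinear_gen {Ω : Signature.{u}} (f : Ω.ops) :
    (Term.op f Term.var : Term Ω (Fin (Ω.arity f))).Polylinear := by
  intro x
  change ∑ i, (Term.var i : Term Ω (Fin (Ω.arity f))).count x = 1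
  rw [Finset.sum_eq_single x] <;> simp +contextual [Term.count]

/-- The generator `f(x_1, …, x_n)` of the free operad. -/
noncomputable def gen (k : Type u) [Field k] {Ω : Signature.{u}} (f : Ω.ops) :
    (Free k Ω).obj (Fin (Ω.arity f)) :=
  mono k (Term.op f Term.var) (Term.polylinear_gen f)

theorem zeta_gen (Ω : Signature.{u}) (f : Ω.ops) (i : Fin (Ω.arity f)) :
    (zeta k Ω).toFun (Fin (Ω.arity f)) (gen k (Ω := Ω.double) ⟨f, i⟩) =
      (gen k f ⊗ₜ[k] permE k i :
        (Free k Ω).obj (Fin (Ω.arity f)) ⊗[k] (PermOperad k).obj (Fin (Ω.arity f))) :=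
  zetaLin_single Ω (Fin (Ω.arity f)) ⟨_, Term.polylinear_gen (Ω := Ω.double) ⟨f, i⟩⟩

/-! ### The procedure `Id ↦ Id^(2)` on sets of polylinear identities -/

/-- The linear map `s ↦ s^x` which attaches superscripts with `x` as the emphasized leaf. -/
noncomputable def dotLin (Ω : Signature.{u}) {I : Type} [Finite I] (x : I) :
    (Free k Ω).obj I →ₗ[k] (Free k Ω.double).obj I :=
  Finsupp.lmapDomain k k
    (fun t : {t : Term Ω I // t.Polylinear} =>
      (⟨t.1.dot x, t.2.dot x⟩ : {t : Term Ω.double I // t.Polylinear}))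

/-- The monomial `f^i(…, g^l(…), …)` with `g^l` in position `j`; the variables of the outer symbol
are the positions other than `j`. -/
def nested (Ω : Signature.{u}) (f g : Ω.ops) (i j : Fin (Ω.arity f)) (l : Fin (Ω.arity g)) :
    Term Ω.double ({s : Fin (Ω.arity f) // s ≠ j} ⊕ Fin (Ω.arity g)) :=
  Term.op (Ω := Ω.double) ⟨f, i⟩ (fun s : Fin (Ω.arity f) =>
    if h : s = j then Term.op (Ω := Ω.double) ⟨g, l⟩ (fun r => Term.var (Sum.inr r))
    else Term.var (Sum.inl ⟨s, h⟩))

theorem nested_polylinear (Ω : Signature.{u}) (f g : Ω.ops) (i j : Fin (Ω.arity f))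
    (l : Fin (Ω.arity g)) : (nested Ω f g i j l).Polylinear := by
  classical
  have hc : ∀ x, (nested Ω f g i j l).count x = ∑ s : Fin (Ω.arity f),
      (if h : s = j then Term.op (Ω := Ω.double) ⟨g, l⟩ (fun r => Term.var (Sum.inr r))
        else Term.var (Sum.inl ⟨s, h⟩) :
        Term Ω.double ({s : Fin (Ω.arity f) // s ≠ j} ⊕ Fin (Ω.arity g))).count x :=
    fun x => rfl
  rintro (⟨s, hs⟩ | r)
  · rw [hc, Finset.sum_eq_single s]
    · simp [hs, Term.count]
    · intro s' _ hne
      by_cases h : s' = j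
      · simp [h, Term.count]
      · simp [h, Term.count, hne]
    · simp
  · rw [hc, Finset.sum_eq_single j]
    · have h : ∑ r' : Fin (Ω.arity g), (Term.var (Sum.inr r') : Term Ω.double
          ({s : Fin (Ω.arity f) // s ≠ j} ⊕ Fin (Ω.arity g))).count (Sum.inr r) = 1 := by
        rw [Finset.sum_eq_single r] <;> simp +contextual [Term.count]
      simp only [dite_true]
      exact h
    · intro s' _ hne
      simp [hne, Term.count]
    · simp

/-- The monomial `nested` as an element of the free operad. -/
noncomputable def nestedMon (k : Type u) [Field k] (Ω : Signature.{u}) (f g : Ω.ops)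
    (i j : Fin (Ω.arity f)) (l : Fin (Ω.arity g)) :
    (Free k Ω.double).obj ({s : Fin (Ω.arity f) // s ≠ j} ⊕ Fin (Ω.arity g)) :=
  mono k (nested Ω f g i j l) (nested_polylinear Ω f g i j l)

/-- The identities of type `Ω^(2)` obtained from a set `S` of polylinear identities of type `Ω`:
`f^i(…, g^l(…), …) = f^i(…, g^p(…), …)` with `g` in a position `j ≠ i`, and `s^i = 0` for `s ∈ S`
and each variable `i` of `s`. -/
inductive DoubleGen {Ω : Signature.{u}} (S : ∀ n : ℕ, Set ((Free k Ω).obj (Fin n))) :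
    ∀ (I : Type) [Finite I], (Free k Ω.double).obj I → Prop
  | zero (f g : Ω.ops) (i j : Fin (Ω.arity f)) (hij : i ≠ j) (l p : Fin (Ω.arity g)) :
      DoubleGen S ({s : Fin (Ω.arity f) // s ≠ j} ⊕ Fin (Ω.arity g))
        (nestedMon k Ω f g i j l - nestedMon k Ω f g i j p)
  | dot (n : ℕ) (s : (Free k Ω).obj (Fin n)) (hs : s ∈ S n) (i : Fin n) :
      DoubleGen S (Fin n) (dotLin Ω i s)

/-- The operad ideal `S^(2)` of all consequences of the identities `DoubleGen S`. -/
noncomputable def doubleIdeal {Ω : Signature.{u}} (S : ∀ n : ℕ, Set ((Free k Ω).obj (Fin n))) :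
    Operad.OpIdeal (Free k Ω.double) :=
  Operad.OpIdeal.span (fun I _ => {x | DoubleGen S I x})

/-! ### Multilinear operations on associative algebras and dialgebras -/

/-- The language with one `n`-ary symbol. -/
def Signature.single (n : ℕ) (hn : 2 ≤ n) : Signature.{u} where
  ops := PUnit
  arity _ := n
  two_le _ := hn

/-- The value of a polylinear polynomial in an algebra with operations `F`. -/
noncomputable def evalPoly {Ω : Signature.{u}} {I : Type} [Finite I] {A : Type v} [AddCommGroup A]
    [Module k A] (F : ∀ f : Ω.ops, (Fin (Ω.arity f) → A) → A) (a : I → A)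
    (p : (Free k Ω).obj I) : A :=
  Finsupp.sum (show {t : Term Ω I // t.Polylinear} →₀ k from p) (fun t c => c • t.1.eval F a)

/-- The product `x_1 x_2 ⋯ x_n` of a non-empty word. -/
def wordProd {A : Type v} [NonUnitalRing A] : List A → A
  | [] => 0
  | x :: l => l.foldl (fun y z => y * z) x

/-- The operation `ω(x_1, …, x_n) = ∑_σ α_σ x_{σ(1)} ⋯ x_{σ(n)}` on an associative algebra. -/
def assocOp {n : ℕ} (α : Equiv.Perm (Fin n) → k) {A : Type v} [NonUnitalRing A] [Module k A]
    (x : Fin n → A) : A :=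
  ∑ σ : Equiv.Perm (Fin n), α σ • wordProd (List.ofFn fun s => x (σ s))

/-- An associative dialgebra; `lt x y` is `x ⊢ y` and `rt x y` is `x ⊣ y`. -/
structure AssocDialgebra (k : Type u) [Field k] where
  carrier : Type u
  [grp : AddCommGroup carrier]
  [mod : Module k carrier]
  lt : carrier →ₗ[k] carrier →ₗ[k] carrier
  rt : carrier →ₗ[k] carrier →ₗ[k] carrier
  rt_lt : ∀ x y z, lt (rt x y) z = lt (lt x y) z
  rt_rt_lt : ∀ x y z, rt x (lt y z) = rt x (rt y z)
  lt_assoc : ∀ x y z, lt x (lt y z) = lt (lt x y) z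
  lt_rt_assoc : ∀ x y z, lt x (rt y z) = rt (lt x y) z
  rt_assoc : ∀ x y z, rt x (rt y z) = rt (rt x y) z

attribute [instance] AssocDialgebra.grp AssocDialgebra.mod

/-- The dialgebra monomial
`x_{σ(1)} ⊢ ⋯ ⊢ x_{σ(j-1)} ⊢ x_{σ(j)} ⊣ x_{σ(j+1)} ⊣ ⋯ ⊣ x_{σ(n)}`. -/
def AssocDialgebra.word (D : AssocDialgebra k) {n : ℕ} (x : Fin n → D.carrier)
    (σ : Equiv.Perm (Fin n)) (j : Fin n) : D.carrier :=
  ((List.finRange n).take j).foldr (fun s y => D.lt (x (σ s)) y)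
    (((List.finRange n).drop (j + 1)).foldl (fun y s => D.rt y (x (σ s))) (x (σ j)))

/-- The operation `ω_i` of the family `BSO(ω)`: the sum over all `σ` of `α_σ` times the dialgebra
monomial in which the center is `x_i`, that is, its position `j` satisfies `σ(j) = i`. -/
def AssocDialgebra.bsoOp (D : AssocDialgebra k) {n : ℕ} (α : Equiv.Perm (Fin n) → k) (i : Fin n)
    (x : Fin n → D.carrier) : D.carrier :=
  ∑ σ : Equiv.Perm (Fin n), α σ • D.word x σ (σ.symm i)

/-- `Id(ω)` in degree `d`: the polylinear identities of all algebras `(A, ω)`, `A` associative. -/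
def idOmega {n : ℕ} (hn : 2 ≤ n) (α : Equiv.Perm (Fin n) → k) (d : ℕ) :
    Set ((Free k (Signature.single n hn)).obj (Fin d)) :=
  {f | ∀ (A : Type u) [NonUnitalRing A] [Module k A] [IsScalarTower k A A] [SMulCommClass k A A]
    (a : Fin d → A), evalPoly (Ω := Signature.single n hn) (fun _ => assocOp α) a f = 0}

/-- `Id(BSO(ω))` in degree `d`: the polylinear identities of all algebras `(D, ω_1, …, ω_n)`, `D` an
associative dialgebra. -/
def idBSO {n : ℕ} (hn : 2 ≤ n) (α : Equiv.Perm (Fin n) → k) (d : ℕ) :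
    Set ((Free k (Signature.single n hn).double).obj (Fin d)) :=
  {f | ∀ (D : AssocDialgebra k) (a : Fin d → D.carrier),
    evalPoly (Ω := (Signature.single n hn).double) (fun p => D.bsoOp α p.2) a f = 0}

/-- `Id(ω)^(2)` in degree `d`. -/
def idOmegaDouble {n : ℕ} (hn : 2 ≤ n) (α : Equiv.Perm (Fin n) → k) (d : ℕ) :
    Set ((Free k (Signature.single n hn).double).obj (Fin d)) :=
  {f | f ∈ (doubleIdeal (idOmega hn α)).carrier (Fin d)}

end

end Dialg

open Dialg

/-! Everything about `S^ω` rests on one fact: an operation of an operad `R` that vanishes on every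
`R`-algebra is zero (`eq_zero_of_forall_satisfies`). For `r` in `R(X)` the witness is the
multilinear part of the free algebra on `X`, with one component `R(S)` for each subset `S` of `X`.
It involves no coinvariants of symmetric groups, so no factorial has to be inverted. Applying `r` to
the generators and reading the component at `X` returns `r` (`MultilinearFree.val_act_gen`).

Every `R`-algebra pulled back along `ω` is special, so the kernel of `S^ω` is `ker ω`
(`mem_identities_specialVariety`). By flatness, `ker (ω ⊗ id)` is the image of `ker ω ⊗ Perm`, and
so is the kernel of `S^ω ⊗ id`. Hence `S^ω ⊗ id` and `S^(ω ⊗ id)` are surjections from `di P` with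
the same kernel. This gives the isomorphism, and also the equality of identities, because the
identities of all algebras over an operad are the elements that become zero in it.

For the BSO problems, `coordLin x f` collects the monomials of `f` with emphasized leaf `x` and
erases their superscripts. Modulo the identities with interchangeable superscripts, `f` is the sum
over `x` of these coordinates with superscripts restored, so `f` lies in `S^(2)` once its
coordinates lie in `S` (`mem_doubleIdeal_of_coordLin`).

The bridge to associative algebras is `AssocDialgebra.IsBimoduleMap.map_bsoEval`: if `φ` is a
homomorphism from a dialgebra to an associative algebra and `ψ` a compatible bimodule map, then `ψ
(f(a))` is the sum over `x` of `coordLin x f` evaluated at `φ ∘ a` with entry `x` replaced by `ψ (a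
x)`. For `A ⊗ Perm`, arguments `b y ⊗ e_y` and `ψ` the coordinate at `x`, only one summand survives,
so the coordinates of a BSO identity are identities of `ω`. For the split null extension `ψ` is
injective, so the generators of `Id(ω)^(2)` vanish on every dialgebra. -/

namespace Dialg

universe v

/-! ### A faithful algebra over an operad -/

namespace MultilinearFree

variable {k : Type u} [Field k] (R : Operad.{u, v} k) {X : Type} [Finite X]

/-- The multilinear part of the free `R`-algebra with the finite set `X` of generators: a component
for each set of generators. -/
abbrev Carrier (R : Operad.{u, v} k) (X : Type) [Finite X] : Type v := ∀ S : Set X, R.obj S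

/-- The component of an element indexed by the image of an embedding `f : T ↪ X`, with the inputs
labelled by `T`. -/
noncomputable def val {T : Type} [Finite T] (f : T ↪ X) : Carrier R X →ₗ[k] R.obj T :=
  R.map (Equiv.ofInjective f f.injective).symm ∘ₗ LinearMap.proj (Set.range f)

variable {R}

/-- The hypothesis forces `S` to be the image of `f` and `e` to be the inverse of `f`. Thus
components at equal but differently presented subsets can be compared without transport along
equalities of sets. -/
theorem val_eq {T : Type} [Finite T] (f : T ↪ X) (a : Carrier R X) (S : Set X) (e : S ≃ T)
    (h : ∀ s, f (e s) = s) : R.map e (a S) = val R f a := by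
  have hS : S = Set.range f := by
    ext x
    constructor
    · intro hx
      exact ⟨e ⟨x, hx⟩, h ⟨x, hx⟩⟩
    · rintro ⟨t, rfl⟩
      have := h (e.symm t)
      rw [e.apply_symm_apply] at this
      rw [this]
      exact (e.symm t).2
  subst hS
  have he : e = (Equiv.ofInjective f f.injective).symm := by
    ext s
    apply f.injective
    rw [h s]
    exact (Equiv.apply_ofInjective_symm f.injective s).symm
  subst he
  rfl

theorem map_val {T T' : Type} [Finite T] [Finite T'] (f : T ↪ X) (g : T' ↪ X) (e : T' ≃ T)
    (h : ∀ t, f (e t) = g t) (a : Carrier R X) : R.map e (val R g a) = val R f a := by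
  change R.map e (R.map _ (a (Set.range g))) = _
  rw [← R.map_trans]
  refine val_eq f a _ _ fun s => ?_
  rw [Equiv.trans_apply, h]
  exact Equiv.apply_ofInjective_symm g.injective s

/-- The restriction of an embedding to a fibre of `c`. -/
def fiberEmb {T J : Type} (c : T → J) (f : T ↪ X) (j : J) : {t : T // c t = j} ↪ X :=
  (Function.Embedding.subtype _).trans f

/-- The summand of `actAt` for `c` is written with the literal fibres of `c`; any other labelling `K
j` of the fibres gives the same element, because `E` restricts to bijections from `K j` to the
fibres and `map_inner` absorbs them. All axioms of the algebra below are obtained by choosing `E`.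
-/
theorem map_comp_fiber {T J : Type} [Finite T] [Finite J] {K : J → Type} [∀ j, Finite (K j)]
    (f : T ↪ X) (c : T → J) (g : ∀ j, K j ↪ X) (E : (Σ j, K j) ≃ T)
    (hE : ∀ p, f (E p) = g p.1 p.2) (hc : ∀ p, c (E p) = p.1) (r : R.obj J)
    (a : J → Carrier R X) :
    R.map (Equiv.sigmaFiberEquiv c) (R.comp r fun j => val R (fiberEmb c f j) (a j)) =
      R.map E (R.comp r fun j => val R (g j) (a j)) := by
  have hb : ∀ j, Function.Bijective
      (fun y : K j => (⟨E ⟨j, y⟩, hc ⟨j, y⟩⟩ : {t : T // c t = j})) := by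
    intro j
    constructor
    · intro y y' h
      have := E.injective (congrArg Subtype.val h)
      simpa using this
    · rintro ⟨t, ht⟩
      obtain ⟨⟨j', y⟩, rfl⟩ := E.surjective t
      obtain rfl : j' = j := (hc ⟨j', y⟩).symm.trans ht
      exact ⟨y, rfl⟩
  have h1 : (fun j => val R (fiberEmb c f j) (a j)) =
      fun j => R.map (Equiv.ofBijective _ (hb j)) (val R (g j) (a j)) := by
    funext j
    exact (map_val _ _ _ (fun y => hE ⟨j, y⟩) _).symm
  rw [h1, ← R.map_inner, ← R.map_trans]
  exact congrArg (fun E => R.map E _) (Equiv.ext fun p => rfl)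

/-- The component of `r(a)` indexed by the image of `f`. -/
noncomputable def actAt {T J : Type} [Finite T] [Finite J] (f : T ↪ X) :
    R.obj J →ₗ[k] MultilinearMap k (fun _ : J => Carrier R X) (R.obj T) :=
  letI := Fintype.ofFinite (T → J)
  -- A map `c` is a decomposition of `T` into parts indexed by `J`, some possibly empty; argument
  -- `j` contributes its component on part `j`.
  ∑ c : T → J,
    { toFun := fun r => (R.map (Equiv.sigmaFiberEquiv c)).compMultilinearMap
        ((R.comp r).compLinearMap fun j => val R (fiberEmb c f j))
      map_add' := by intros; ext; simp
      map_smul' := by intros; ext; simp }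

theorem actAt_apply {T J : Type} [Finite T] [Finite J] [Fintype (T → J)] (f : T ↪ X)
    (r : R.obj J) (a : J → Carrier R X) : actAt f r a =
      ∑ c : T → J, R.map (Equiv.sigmaFiberEquiv c)
        (R.comp r fun j => val R (fiberEmb c f j) (a j)) := by
  obtain rfl : ‹Fintype (T → J)› = Fintype.ofFinite _ := Subsingleton.elim _ _
  simp only [actAt, LinearMap.sum_apply, sum_apply]
  rfl

theorem map_actAt {T T' J : Type} [Finite T] [Finite T'] [Finite J] (f : T ↪ X) (g : T' ↪ X)
    (e : T' ≃ T) (h : ∀ t, f (e t) = g t) (r : R.obj J) (a : J → Carrier R X) :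
    R.map e (actAt g r a) = actAt f r a := by
  have := Fintype.ofFinite (T → J)
  have := Fintype.ofFinite (T' → J)
  rw [actAt_apply, actAt_apply, map_sum]
  refine Fintype.sum_equiv (e.arrowCongr (Equiv.refl J)) _ _ fun c => ?_
  rw [← R.map_trans]
  symm
  refine map_comp_fiber _ _ _ _ (fun p => ?_) (fun p => ?_) r a
  · exact h _
  · simpa using p.2.2

/-- The operation `r` of the algebra. -/
noncomputable def act {J : Type} [Finite J] :
    R.obj J →ₗ[k] MultilinearMap k (fun _ : J => Carrier R X) (Carrier R X) where
  toFun r := MultilinearMap.pi fun S => actAt (Function.Embedding.subtype (· ∈ S)) r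
  map_add' _ _ := by ext; simp
  map_smul' _ _ := by ext; simp

theorem val_act {T J : Type} [Finite T] [Finite J] (f : T ↪ X) (r : R.obj J)
    (a : J → Carrier R X) : val R f (act r a) = actAt f r a :=
  map_actAt _ _ _ (fun t => Equiv.apply_ofInjective_symm f.injective t) r a

/-- Equality may be tested after relabelling each subset by an arbitrary finite type, which is the
form in which `val_act` computes components. -/
theorem ext_val {a b : Carrier R X}
    (h : ∀ (T : Type) [Finite T] (f : T ↪ X), val R f a = val R f b) : a = b := by
  funext S
  have h1 := fun a : Carrier R X =>
    val_eq (Function.Embedding.subtype (· ∈ S)) a S (Equiv.refl _) (fun _ => rfl)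
  have := h S (Function.Embedding.subtype (· ∈ S))
  rwa [← h1, ← h1, R.map_refl, R.map_refl] at this

theorem act_map {I J : Type} [Finite I] [Finite J] (e : I ≃ J) (r : R.obj I)
    (a : J → Carrier R X) : act (R.map e r) a = act r (fun i => a (e i)) := by
  refine ext_val fun T _ f => ?_
  have := Fintype.ofFinite (T → I)
  have := Fintype.ofFinite (T → J)
  rw [val_act, val_act, actAt_apply, actAt_apply]
  symm
  refine Fintype.sum_equiv ((Equiv.refl T).arrowCongr e) _ _ fun c => ?_
  rw [← R.map_outer e r, ← R.map_trans]
  -- The fibre of `e ∘ c` over `e i` is the fibre of `c` over `i`; it is kept in the first form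
  -- because `map_outer` produces it.
  refine map_comp_fiber (K := fun i => {t : T // e (c t) = e i}) f c
    (fun i => fiberEmb (fun t => e (c t)) f (e i)) _ (fun p => ?_) (fun p => ?_) r _
  · rfl
  · obtain ⟨i, t, ht⟩ := p
    exact e.injective ht

/-- There is a single decomposition of `T` into one part, and its summand is reduced by `one_comp`.
-/
theorem act_one (a : Unit → Carrier R X) : act R.one a = a () := by
  refine ext_val fun T _ f => ?_
  have := Fintype.ofFinite (T → Unit)
  rw [val_act, actAt_apply, Fintype.sum_unique]
  refine (map_comp_fiber f default (fun _ => f) (Equiv.uniqueSigma fun _ : Unit => T)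
    (fun p => rfl) (fun p => rfl) R.one a).trans ?_
  exact R.one_comp (val R f (a ()))

/-- A map to a disjoint union is a partition of its source with a map from each part. -/
def sigmaArrowEquiv (T : Type) {I : Type} (J : I → Type) :
    (Σ d : T → I, ∀ i, {t : T // d t = i} → J i) ≃ (T → Σ i, J i) where
  toFun p t := ⟨p.1 t, p.2 (p.1 t) ⟨t, rfl⟩⟩
  invFun c := ⟨fun t => (c t).1, fun i t => t.2 ▸ (c t.1).2⟩
  left_inv p := by
    obtain ⟨d, e⟩ := p
    refine Sigma.ext rfl (heq_of_eq ?_)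
    funext i t
    obtain ⟨t, rfl⟩ := t
    rfl
  right_inv c := rfl

/-- Decomposing `T` along `I` and then each part along `J i` is the same as decomposing `T` along `Σ
i, J i`. Under this bijection of index sets the summands agree by associativity in `R`. -/
theorem act_comp {I : Type} [Finite I] {J : I → Type} [∀ i, Finite (J i)] (r : R.obj I)
    (b : ∀ i, R.obj (J i)) (a : (Σ i, J i) → Carrier R X) :
    act (R.comp r b) a = act r (fun i => act (b i) fun j => a ⟨i, j⟩) := by
  classical
  refine ext_val fun T _ f => ?_
  have := Fintype.ofFinite I
  have := Fintype.ofFinite (T → I)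
  have := Fintype.ofFinite (T → Σ i, J i)
  have := fun (d : T → I) i => Fintype.ofFinite ({t : T // d t = i} → J i)
  rw [val_act, val_act, actAt_apply, actAt_apply]
  simp only [val_act, actAt_apply, MultilinearMap.map_sum, map_sum]
  rw [← Fintype.sum_sigma']
  symm
  refine Fintype.sum_equiv (sigmaArrowEquiv T J) _ _ ?_
  rintro ⟨d, e⟩
  dsimp only
  rw [← R.map_inner]
  have h := R.assoc (L := fun i j => {s : {t : T // d t = i} // e i s = j}) r b
    fun p : Σ i, J i => val R (fiberEmb (e p.1) (fiberEmb d f p.1) p.2) (a p)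
  rw [← h, ← R.map_trans, ← R.map_trans]
  symm
  refine map_comp_fiber f _
    (fun p : Σ i, J i => fiberEmb (e p.1) (fiberEmb d f p.1) p.2) _ (fun p => ?_) (fun p => ?_) _ _
  · rfl
  · obtain ⟨⟨i, j⟩, ⟨⟨t, h₁⟩, h₂⟩⟩ := p
    change d t = i at h₁
    subst h₁
    change e (d t) ⟨t, rfl⟩ = j at h₂
    subst h₂
    rfl

/-- The structure morphism. -/
noncomputable def str (R : Operad.{u, v} k) (X : Type) [Finite X] :
    Operad.Hom R (Operad.endo k (Carrier R X)) where
  toFun _ _ := act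
  map_map e r := MultilinearMap.ext fun a => act_map e r a
  map_one := MultilinearMap.ext fun a => act_one a
  map_comp r b := MultilinearMap.ext fun a => act_comp r b a

open Classical in
/-- The generators. -/
noncomputable def gen (R : Operad.{u, v} k) {X : Type} [Finite X] (x : X) : Carrier R X := fun S =>
  if h : S = {x} then R.map ((Equiv.ofUnique Unit ({x} : Set X)).trans (Equiv.setCongr h.symm)) R.one
  else 0

theorem val_gen_self (x : X) (f : Unit ↪ X) (h : f () = x) : val R f (gen R x) = R.one := by
  rw [← val_eq f _ {x} (Equiv.ofUnique _ _) (fun s => h.trans s.2.symm), gen, dif_pos rfl,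
    ← R.map_trans]
  exact R.map_refl _

/-- A generator lives only in the component of its own singleton. -/
theorem val_gen_of_ne {T : Type} [Finite T] (f : T ↪ X) (x : X) (t : T) (h : f t ≠ x) :
    val R f (gen R x) = 0 := by
  have hS : Set.range f ≠ {x} := by
    intro hS
    have : f t ∈ Set.range f := ⟨t, rfl⟩
    rw [hS] at this
    exact h this
  change R.map _ (gen R x (Set.range f)) = 0
  rw [gen, dif_neg hS, map_zero]

/-- Among the decompositions `X → X` only the identity gives each generator its own singleton, and
its summand is `r` composed with units. This recovers `r` from its action. -/
theorem val_act_gen (r : R.obj X) :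
    val R (Function.Embedding.refl X) (act r fun x => gen R x) = r := by
  have := Fintype.ofFinite (X → X)
  rw [val_act, actAt_apply, Fintype.sum_eq_single id]
  · refine (map_comp_fiber (K := fun _ => Unit) (Function.Embedding.refl X) id
      (fun x => ⟨fun _ => x, fun _ _ _ => rfl⟩) (Equiv.sigmaUnique X fun _ => Unit)
      (fun p => rfl) (fun p => rfl) r _).trans ?_
    rw [show (fun x => val R _ (gen R x)) = fun _ : X => R.one from
      funext fun x => val_gen_self x _ rfl]
    exact R.comp_one r
  · intro c hc
    obtain ⟨x, hx⟩ := Function.ne_iff.1 hc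
    -- Since `c x ≠ x`, the part indexed by `c x` contains the foreign point `x`, so the generator
    -- `c x` has zero component there.
    rw [(R.comp r).map_coord_zero (c x), map_zero]
    exact val_gen_of_ne _ _ ⟨x, rfl⟩ (Ne.symm hx)

end MultilinearFree

/-! ### Special identities as kernels, and their behaviour under the product with `Perm`. -/

section

variable {k : Type u} [Field k]

/-- An operation that vanishes on all algebras over an operad is zero. -/
theorem eq_zero_of_forall_satisfies {R : Operad.{u, u} k} {I : Type} [Finite I] (r : R.obj I)
    (h : ∀ A : Alg R, A.Satisfies r) : r = 0 := by
  have h1 : MultilinearFree.act r (fun x => MultilinearFree.gen R x) = 0 :=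
    h ⟨MultilinearFree.Carrier R I, MultilinearFree.str R I⟩ (fun x => MultilinearFree.gen R x)
  rw [← MultilinearFree.val_act_gen r, h1, map_zero]

theorem forall_satisfies_iff {R : Operad.{u, u} k} {I : Type} [Finite I] (r : R.obj I) :
    (∀ A : Alg R, A.Satisfies r) ↔ r = 0 := by
  refine ⟨eq_zero_of_forall_satisfies r, ?_⟩
  rintro rfl A a
  unfold Alg.act
  rw [map_zero]
  rfl

/-- Special algebras factor through `ω`, and identities pass to subalgebras and images. Conversely,
the pullbacks of all `R`-algebras are special, and together they detect every nonzero element of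
`R`. -/
theorem mem_identities_specialVariety {P R : Operad.{u, u} k} (ω : Operad.Hom P R) {I : Type}
    [Finite I] (f : P.obj I) :
    f ∈ (identities (Alg.InSpecialVariety ω)).carrier I ↔ ω.toFun I f = 0 := by
  constructor
  · intro h
    refine eq_zero_of_forall_satisfies _ fun A => ?_
    -- A special algebra is in the variety as its own subalgebra and its own image.
    exact h ⟨A.carrier, A.str.comp ω⟩ ⟨⟨A.carrier, A.str.comp ω⟩, ⟨A.carrier, A.str.comp ω⟩,
      LinearMap.id, LinearMap.id, ⟨A.str, rfl⟩, fun _ _ _ _ => rfl, fun _ _ h => h,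
      fun _ _ _ _ => rfl, fun a => ⟨a, rfl⟩⟩
  · rintro h A ⟨B, B₁, ι, φ, ⟨β, hβ⟩, hι, hinj, hφ, hsurj⟩ a
    choose b hb using fun i => hsurj (a i)
    obtain rfl : (fun i => φ (b i)) = a := funext hb
    rw [← hφ]
    have h0 : B₁.act f b = 0 := by
      apply hinj
      rw [hι, map_zero]
      unfold Alg.act
      rw [hβ]
      change endoEval (β.toFun I (ω.toFun I f)) _ = 0
      rw [h, map_zero]
      rfl
    rw [h0, map_zero]

theorem specialMk_eq_zero_iff {P R : Operad.{u, u} k} (ω : Operad.Hom P R) {I : Type} [Finite I]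
    (f : P.obj I) : (specialMk ω).toFun I f = 0 ↔ ω.toFun I f = 0 :=
  (Submodule.Quotient.mk_eq_zero _).trans (mem_identities_specialVariety ω f)

theorem specialMk_surjective {P R : Operad.{u, u} k} (ω : Operad.Hom P R) :
    (specialMk ω).Surjective := fun _ _ => Submodule.mkQ_surjective _

theorem diMap_surjective {P Q : Operad.{u, u} k} {f : Operad.Hom P Q} (hf : f.Surjective) :
    (diMap f).Surjective := fun I _ => TensorProduct.map_surjective (hf I) fun x => ⟨x, rfl⟩

/-- By flatness over a field the kernel of `f ⊗ id` is the image of `ker f ⊗ Perm(I)`, so it depends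
only on `ker f`. -/
theorem diMap_eq_zero_congr {P Q Q' : Operad.{u, u} k} {f : Operad.Hom P Q} {g : Operad.Hom P Q'}
    (h : ∀ (I : Type) [Finite I] (a : P.obj I), f.toFun I a = 0 ↔ g.toFun I a = 0)
    {I : Type} [Finite I] (a : (di P).obj I) :
    (diMap f).toFun I a = 0 ↔ (diMap g).toFun I a = 0 := by
  have hk : LinearMap.ker (f.toFun I) = LinearMap.ker (g.toFun I) := by
    ext x
    exact h I x
  have key : ∀ {M N : Type u} [AddCommGroup M] [Module k M] [AddCommGroup N] [Module k N]
      (φ : M →ₗ[k] N) (L : Type u) [AddCommGroup L] [Module k L],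
      LinearMap.ker (TensorProduct.map φ (LinearMap.id : L →ₗ[k] L)) =
        LinearMap.range (TensorProduct.map (LinearMap.ker φ).subtype (LinearMap.id : L →ₗ[k] L)) := by
    intro M N _ _ _ _ φ L _ _
    exact LinearMap.exact_iff.1 (Module.Flat.rTensor_exact L
      (LinearMap.exact_subtype_ker_map φ))
  change a ∈ LinearMap.ker (TensorProduct.map (f.toFun I) LinearMap.id) ↔
    a ∈ LinearMap.ker (TensorProduct.map (g.toFun I) LinearMap.id)
  rw [key, key, hk]

theorem Operad.Hom.ext_toFun {P Q : Operad.{u, u} k} {f g : Operad.Hom P Q}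
    (h : ∀ (I : Type) [Finite I] (a : P.obj I), f.toFun I a = g.toFun I a) : f = g := by
  cases f
  cases g
  congr 1
  funext I _
  exact LinearMap.ext (h I)

/-- Two surjective morphisms with the same kernels have isomorphic targets. -/
theorem Operad.Hom.exists_bijective {P Q Q' : Operad.{u, u} k} (f : Operad.Hom P Q)
    (g : Operad.Hom P Q') (hf : f.Surjective) (hg : g.Surjective)
    (h : ∀ (I : Type) [Finite I] (a : P.obj I), f.toFun I a = 0 ↔ g.toFun I a = 0) :
    ∃ e : Operad.Hom Q Q', e.Bijective ∧ e.comp f = g := by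
  have hk : ∀ (I : Type) [Finite I], LinearMap.ker (f.toFun I) ≤ LinearMap.ker (g.toFun I) :=
    fun I _ a => (h I a).1
  have hex : ∀ (I : Type) [Finite I], ∃ φ : Q.obj I →ₗ[k] Q'.obj I, φ ∘ₗ f.toFun I = g.toFun I := by
    intro I _
    -- The induced map is `g ∘ s` for a linear section `s` of `f`; the choice of `s` is immaterial
    -- because `s (f a) - a` lies in `ker f`, hence in `ker g`.
    obtain ⟨s, hs⟩ := (f.toFun I).exists_rightInverse_of_surjective
      (LinearMap.range_eq_top.2 (hf I))
    refine ⟨g.toFun I ∘ₗ s, LinearMap.ext fun a => ?_⟩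
    have h1 : f.toFun I (s (f.toFun I a) - a) = 0 := by
      rw [map_sub]
      exact sub_eq_zero.2 (LinearMap.congr_fun hs _)
    have h2 := hk I h1
    rw [LinearMap.mem_ker, map_sub] at h2
    exact sub_eq_zero.1 h2
  choose φ hφ using hex
  have hφ' : ∀ (I : Type) [Finite I] (a : P.obj I), φ I (f.toFun I a) = g.toFun I a :=
    fun I _ a => LinearMap.congr_fun (hφ I) a
  refine ⟨⟨fun I _ => φ I, ?_, ?_, ?_⟩, ?_, ?_⟩
  · intro I J _ _ e a
    obtain ⟨a, rfl⟩ := hf I a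
    rw [← f.map_map, hφ', hφ', g.map_map]
  · rw [← f.map_one, hφ', g.map_one]
  · intro I _ J _ a b
    obtain ⟨a, rfl⟩ := hf I a
    choose b' hb' using fun i => hf (J i) (b i)
    obtain rfl : (fun i => f.toFun (J i) (b' i)) = b := funext hb'
    rw [← f.map_comp, hφ', hφ', g.map_comp]
    simp only [hφ']
  · intro I _
    constructor
    · refine (injective_iff_map_eq_zero (φ I)).2 fun a ha => ?_
      obtain ⟨a, rfl⟩ := hf I a
      rw [hφ'] at ha
      exact (h I a).2 ha
    · intro b
      obtain ⟨a, rfl⟩ := hg I b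
      exact ⟨_, hφ' I a⟩
  · exact Operad.Hom.ext_toFun fun I _ a => hφ' I a

/-- Both sides say that `a` is killed by `ω ⊗ id`: the right one by the description of special
identities for `diMap ω`, the left one because `S^ω` and `ω` have equal kernels before tensoring. -/
theorem di_special_eq_zero_iff {P R : Operad.{u, u} k} (ω : Operad.Hom P R) {I : Type} [Finite I]
    (a : (di P).obj I) :
    (diMap (specialMk ω)).toFun I a = 0 ↔ (specialMk (diMap ω)).toFun I a = 0 := by
  rw [specialMk_eq_zero_iff]
  exact diMap_eq_zero_congr (fun I _ a => specialMk_eq_zero_iff ω a) a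

end

end Dialg

namespace Dialg

universe v w

/-! ### Algebras over free operads -/

namespace Term

variable {Ω : Signature.{u}} {X Y : Type}

theorem eval_bind {A : Type v} (F : ∀ f : Ω.ops, (Fin (Ω.arity f) → A) → A) (t : Term Ω X)
    (g : X → Term Ω Y) (a : Y → A) :
    (t.bind g).eval F a = t.eval F (fun x => (g x).eval F a) := by
  induction t with
  | var x => rfl
  | op f ts ih => exact congrArg (F f) (funext ih)

theorem eval_rename {A : Type v} (F : ∀ f : Ω.ops, (Fin (Ω.arity f) → A) → A) (t : Term Ω X)
    (g : X → Y) (a : Y → A) : (t.rename g).eval F a = t.eval F (fun x => a (g x)) := by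
  rw [rename_eq_bind, eval_bind]
  rfl

theorem count_op (f : Ω.ops) (ts : Fin (Ω.arity f) → Term Ω X) (x : X) :
    (op f ts).count x = ∑ i, (ts i).count x := rfl

theorem count_le_op (f : Ω.ops) (ts : Fin (Ω.arity f) → Term Ω X) (i : Fin (Ω.arity f)) (x : X) :
    (ts i).count x ≤ (op f ts).count x :=
  Finset.single_le_sum (f := fun i => (ts i).count x) (fun _ _ => Nat.zero_le _)
    (Finset.mem_univ i)

theorem eval_congr {A : Type v} (F : ∀ f : Ω.ops, (Fin (Ω.arity f) → A) → A) (t : Term Ω X)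
    (a a' : X → A) (h : ∀ x, t.count x ≠ 0 → a x = a' x) : t.eval F a = t.eval F a' := by
  induction t with
  | var x => exact h x (by simp [count])
  | op f ts ih =>
    refine congrArg (F f) (funext fun i => ih i fun x hx => h x ?_)
    have := count_le_op f ts i x
    omega

/-- A variable that occurs once in `f(ts)` occurs in just one of the branches. -/
theorem exists_branch {f : Ω.ops} {ts : Fin (Ω.arity f) → Term Ω X} {x : X}
    (h : (op f ts).count x = 1) :
    ∃ i, (ts i).count x = 1 ∧ ∀ j, j ≠ i → (ts j).count x = 0 := by
  rw [count_op] at h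
  obtain ⟨i, -, hi⟩ := Finset.exists_ne_zero_of_sum_ne_zero (h.trans_ne one_ne_zero)
  rw [← Finset.add_sum_erase _ _ (Finset.mem_univ i)] at h
  refine ⟨i, by omega, fun j hj => ?_⟩
  have h0 : ∑ j ∈ Finset.univ.erase i, (ts j).count x = 0 := by omega
  exact Finset.sum_eq_zero_iff.1 h0 j (by simp [hj])

/-- A variable that occurs once affects a single branch at every level, so the term is a composition
of linear maps in it. Only the one variable `x` is constrained, as the branches of a polylinear term
are not polylinear over all of `X`. -/
theorem eval_update {k : Type w} [CommSemiring k] {A : Type v} [AddCommMonoid A] [Module k A]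
    [DecidableEq X] (F : ∀ f : Ω.ops, MultilinearMap k (fun _ : Fin (Ω.arity f) => A) A)
    (t : Term Ω X) (x : X) (ht : t.count x = 1) (a : X → A) :
    ∃ L : A →ₗ[k] A, ∀ v, t.eval (fun f => F f) (Function.update a x v) = L v := by
  induction t with
  | var y =>
    obtain rfl : y = x := by
      by_contra h
      simp [count, h] at ht
    exact ⟨LinearMap.id, fun v => by simp [eval]⟩
  | op f ts ih =>
    obtain ⟨i, hi, h0⟩ := exists_branch ht
    obtain ⟨L, hL⟩ := ih i hi
    refine ⟨(F f).toLinearMap (fun j => (ts j).eval (fun f => F f) a) i ∘ₗ L, fun v => ?_⟩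
    refine congrArg (F f) (funext fun j => ?_)
    rcases eq_or_ne j i with rfl | hj
    · simp [hL]
    · rw [Function.update_of_ne hj]
      refine eval_congr _ _ _ _ fun y hy => Function.update_of_ne ?_ _ _
      rintro rfl
      exact hy (h0 j hj)

/-- The value of a polylinear term is a multilinear function of the values of the variables. -/
def evalMultilinear {k : Type w} [CommSemiring k] {A : Type v} [AddCommMonoid A] [Module k A]
    (F : ∀ f : Ω.ops, MultilinearMap k (fun _ : Fin (Ω.arity f) => A) A) (t : Term Ω X)
    (ht : t.Polylinear) : MultilinearMap k (fun _ : X => A) A where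
  toFun a := t.eval (fun f => F f) a
  map_update_add' a x v v' := by
    obtain ⟨L, hL⟩ := eval_update F t x (ht x) a
    simp only [hL, map_add]
  map_update_smul' a x c v := by
    obtain ⟨L, hL⟩ := eval_update F t x (ht x) a
    simp only [hL, map_smul]

theorem count_rename (t : Term Ω X) [Fintype X] (g : X → Y) (y : Y) [DecidableEq Y] :
    (t.rename g).count y = ∑ x, if g x = y then t.count x else 0 := by
  classical
  induction t with
  | var z =>
    rw [Finset.sum_eq_single z]
    · simp [rename, count]
    · intro x _ hx
      simp [count, hx.symm]
    · simp
  | op f ts ih =>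
    simp only [rename, count_op, ih]
    rw [Finset.sum_comm]
    refine Finset.sum_congr rfl fun x _ => ?_
    split_ifs <;> simp

/-- Since `t` is polylinear, the number of occurrences of `y` after renaming is the number of its
preimages under `g`. -/
theorem bijective_of_polylinear_rename [Finite X] {t : Term Ω X} (ht : t.Polylinear) {g : X → Y}
    (h : (t.rename g).Polylinear) : Function.Bijective g := by
  classical
  have := Fintype.ofFinite X
  have hc : ∀ y, (Finset.univ.filter fun x => g x = y).card = 1 := by
    intro y
    have := h y
    rw [count_rename] at this
    simpa [ht _] using this
  refine (Function.bijective_iff_existsUnique g).2 fun y => ?_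
  obtain ⟨x, hx⟩ := Finset.card_eq_one.1 (hc y)
  simp only [Finset.ext_iff, Finset.mem_filter, Finset.mem_univ, true_and,
    Finset.mem_singleton] at hx
  exact ⟨x, (hx x).2 rfl, fun z hz => (hx z).1 hz⟩

end Term

section

variable {k : Type u} [Field k] {Ω : Signature.{u}}

theorem free_induction {I : Type} [Finite I] {p : (Free k Ω).obj I → Prop}
    (zero : p 0) (add : ∀ f g, p f → p g → p (f + g))
    (smul_mono : ∀ (c : k) (t : Term Ω I) (ht : t.Polylinear), p (c • mono k t ht))
    (f : (Free k Ω).obj I) : p f := by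
  refine Finsupp.induction_linear (motive := p) f zero add fun t c => ?_
  have h : Finsupp.single t c = c • Finsupp.single t (1 : k) := by simp
  rw [h]
  exact smul_mono c t.1 t.2

theorem free_hom_ext {I : Type} [Finite I] {M : Type*} [AddCommMonoid M] [Module k M]
    {φ ψ : (Free k Ω).obj I →ₗ[k] M}
    (h : ∀ (t : Term Ω I) (ht : t.Polylinear), φ (mono k t ht) = ψ (mono k t ht)) : φ = ψ := by
  refine LinearMap.ext fun f => ?_
  induction f using free_induction with
  | zero => simp
  | add f g hf hg => rw [map_add, map_add, hf, hg]
  | smul_mono c t ht => rw [map_smul, map_smul, h]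

/-- The linear map on polylinear polynomials with given values on monomials. -/
noncomputable def freeLift {I : Type} [Finite I] {M : Type*} [AddCommGroup M] [Module k M]
    (φ : {t : Term Ω I // t.Polylinear} → M) : (Free k Ω).obj I →ₗ[k] M :=
  Finsupp.lift M k {t : Term Ω I // t.Polylinear} φ

theorem freeLift_mono {I : Type} [Finite I] {M : Type*} [AddCommGroup M] [Module k M]
    (φ : {t : Term Ω I // t.Polylinear} → M) (t : Term Ω I) (ht : t.Polylinear) :
    freeLift φ (mono k t ht) = φ ⟨t, ht⟩ := by
  have : Finsupp.lift M k {t : Term Ω I // t.Polylinear} φ (Finsupp.single ⟨t, ht⟩ 1) =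
      φ ⟨t, ht⟩ := by simp
  exact this

/-- The value of a polylinear polynomial as a multilinear function. -/
noncomputable def freeStrLin {A : Type v} [AddCommGroup A] [Module k A]
    (F : ∀ f : Ω.ops, MultilinearMap k (fun _ : Fin (Ω.arity f) => A) A) (I : Type) [Finite I] :
    (Free k Ω).obj I →ₗ[k] (Operad.endo k A).obj I :=
  freeLift fun t => (t.1.evalMultilinear F t.2 : (Operad.endo k A).obj I)

theorem freeStrLin_mono {A : Type v} [AddCommGroup A] [Module k A]
    (F : ∀ f : Ω.ops, MultilinearMap k (fun _ : Fin (Ω.arity f) => A) A) {I : Type} [Finite I]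
    (t : Term Ω I) (ht : t.Polylinear) :
    freeStrLin F I (mono k t ht) = (t.evalMultilinear F ht : (Operad.endo k A).obj I) :=
  freeLift_mono _ t ht

/-- The algebra over the free operad with given multilinear operations. -/
noncomputable def freeStr {A : Type v} [AddCommGroup A] [Module k A]
    (F : ∀ f : Ω.ops, MultilinearMap k (fun _ : Fin (Ω.arity f) => A) A) :
    Operad.Hom (Free k Ω) (Operad.endo k A) where
  toFun I _ := freeStrLin F I
  map_map {I J _ _} e f := by
    refine LinearMap.congr_fun (f := freeStrLin F J ∘ₗ (Free k Ω).map e)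
      (g := (Operad.endo k A).map e ∘ₗ freeStrLin F I) (free_hom_ext fun t ht => ?_) f
    rw [LinearMap.comp_apply, LinearMap.comp_apply, map_mono, freeStrLin_mono, freeStrLin_mono]
    exact MultilinearMap.ext fun a => Term.eval_rename _ _ _ _
  map_one := by
    refine (freeStrLin_mono F _ ((termOperad Ω).one).2).trans ?_
    exact MultilinearMap.ext fun a => rfl
  map_comp {I _ J _} a b := by
    refine inner_of_span (M := fun i => {t : Term Ω (J i) // t.Polylinear} →₀ k)
      (W := fun i => (Operad.endo k A).obj (J i))
      ((Free k Ω).comp (J := J)) (freeStrLin F (Σ i, J i)) (fun i => freeStrLin F (J i))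
      ((Operad.endo k A).comp ∘ₗ freeStrLin F I) (span_single_range k _)
      (fun i => span_single_range k {t : Term Ω (J i) // t.Polylinear}) ?_ a b
    intro a b
    refine (congrArg _ (comp_mono k a.1 a.2 (fun i => (b i).1) (fun i => (b i).2))).trans ?_
    rw [freeStrLin_mono]
    have h1 := freeStrLin_mono F a.1 a.2
    have h2 : (fun i => freeStrLin F (J i) (mono k (b i).1 (b i).2)) =
        fun i => ((b i).1.evalMultilinear F (b i).2 : (Operad.endo k A).obj (J i)) :=
      funext fun i => freeStrLin_mono F _ _
    refine Eq.trans ?_ (congrArg₂ (fun x y => (Operad.endo k A).comp x y) h1 h2).symm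
    refine MultilinearMap.ext fun c => ?_
    change Term.eval _ _ _ = Term.eval _ _ _
    rw [Term.eval_bind]
    exact congrArg (fun a' => a.1.eval _ a') (funext fun i => Term.eval_rename _ _ _ _)

theorem evalPoly_mono {I : Type} [Finite I] {A : Type v} [AddCommGroup A] [Module k A]
    (F : ∀ f : Ω.ops, (Fin (Ω.arity f) → A) → A) (a : I → A) (t : Term Ω I) (ht : t.Polylinear) :
    evalPoly F a (mono k t ht) = t.eval F a := by
  have : Finsupp.sum (Finsupp.single (⟨t, ht⟩ : {t : Term Ω I // t.Polylinear}) (1 : k))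
      (fun t c => c • t.1.eval F a) = t.eval F a := by simp
  exact this

/-- The value of a polylinear polynomial, as a linear function of the polynomial. -/
noncomputable def evalPolyLin {I : Type} [Finite I] {A : Type v} [AddCommGroup A] [Module k A]
    (F : ∀ f : Ω.ops, (Fin (Ω.arity f) → A) → A) (a : I → A) : (Free k Ω).obj I →ₗ[k] A :=
  freeLift fun t => t.1.eval F a

theorem evalPolyLin_apply {I : Type} [Finite I] {A : Type v} [AddCommGroup A] [Module k A]
    (F : ∀ f : Ω.ops, (Fin (Ω.arity f) → A) → A) (a : I → A) (f : (Free k Ω).obj I) :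
    evalPolyLin F a f = evalPoly F a f :=
  Finsupp.lift_apply A k _ _ _

theorem freeStr_apply {I : Type} [Finite I] {A : Type v} [AddCommGroup A] [Module k A]
    (F : ∀ f : Ω.ops, MultilinearMap k (fun _ : Fin (Ω.arity f) => A) A) (a : I → A)
    (f : (Free k Ω).obj I) :
    endoEval ((freeStr F).toFun I f) a = evalPoly (fun p => F p) a f := by
  rw [← evalPolyLin_apply]
  induction f using free_induction with
  | zero => rw [map_zero, map_zero]; rfl
  | add f g hf hg => rw [map_add, map_add, ← hf, ← hg]; rfl
  | smul_mono c t ht =>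
    rw [map_smul, map_smul, evalPolyLin, freeLift_mono]
    exact congrArg (fun z => c • endoEval z a) (freeStrLin_mono F t ht)

theorem act_comp {P : Operad.{u, u} k} (A : Alg P) {I : Type} [Finite I] {J : I → Type}
    [∀ i, Finite (J i)] (f : P.obj I) (g : ∀ i, P.obj (J i)) (a : (Σ i, J i) → A.carrier) :
    A.act (P.comp f g) a = A.act f (fun i => A.act (g i) fun j => a ⟨i, j⟩) := by
  unfold Alg.act
  rw [A.str.map_comp]
  rfl

theorem act_map {P : Operad.{u, u} k} (A : Alg P) {I J : Type} [Finite I] [Finite J] (e : I ≃ J)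
    (f : P.obj I) (a : J → A.carrier) : A.act (P.map e f) a = A.act f (fun i => a (e i)) := by
  unfold Alg.act
  rw [A.str.map_map]
  rfl

/-- Every term is obtained by renaming the variables of a polylinear term. -/
theorem exists_linearization (A : Alg (Free k Ω)) {X : Type} (t : Term Ω X) :
    ∃ (Y : Type) (_ : Finite Y) (s : Term Ω Y) (hs : s.Polylinear) (g : Y → X),
      s.rename g = t ∧ ∀ a : X → A.carrier, A.act (mono k s hs) (fun y => a (g y)) =
        t.eval (fun f b => A.act (gen k f) b) a := by
  induction t with
  | var x =>
    refine ⟨Unit, inferInstance, _, ((termOperad Ω).one).2, fun _ => x, rfl, fun a => ?_⟩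
    change endoEval (A.str.toFun Unit (Free k Ω).one) _ = _
    rw [A.str.map_one]
    rfl
  | op f ts ih =>
    choose Y hY s hs g hg h using ih
    -- The branches may share variables; taking the disjoint union of their variable sets separates
    -- them and makes the grafted term polylinear.
    refine ⟨Σ i, Y i, inferInstance, _, (Term.polylinear_gen f).graft hs,
      fun p => g p.1 p.2, ?_, fun a => ?_⟩
    · change Term.op f _ = _
      congr 1
      funext i
      rw [← hg i]
      simp only [Term.bind, Term.rename_eq_bind, Term.bind_bind]
    · rw [← comp_mono k _ (Term.polylinear_gen f) s hs, act_comp]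
      simp only [h]
      rfl

/-- Direct induction fails, since branches of `t` are not polylinear over `I`. Instead `t` is a
renaming of the linearization on which the claim is known, and a renaming between polylinear terms
is a bijection, so equivariance applies. -/
theorem act_mono (A : Alg (Free k Ω)) {I : Type} [Finite I] (t : Term Ω I) (ht : t.Polylinear)
    (a : I → A.carrier) :
    A.act (mono k t ht) a = t.eval (fun f b => A.act (gen k f) b) a := by
  obtain ⟨Y, _, s, hs, g, rfl, h⟩ := exists_linearization A t
  rw [← h]
  have := map_mono k (Equiv.ofBijective g (Term.bijective_of_polylinear_rename hs ht)) s hs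
  exact (congrArg (fun f => A.act f a) this.symm).trans (act_map _ _ _ _)

end

/-! ### Reduction of terms with superscripts -/

/-- The coordinates are exchanged one at a time, and transitivity of `r` joins the steps. -/
theorem rel_of_forall_update {ι A B : Type*} [Finite ι] [DecidableEq ι] (φ : (ι → A) → B)
    (r : B → B → Prop) (hr : ∀ b, r b b) (ht : ∀ a b c, r a b → r b c → r a c)
    (q : ι → A → A → Prop)
    (h : ∀ (c : ι → A) (i : ι) (x y : A), q i x y →
      r (φ (Function.update c i x)) (φ (Function.update c i y)))
    (c c' : ι → A) (hc : ∀ i, q i (c i) (c' i)) : r (φ c) (φ c') := by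
  have := Fintype.ofFinite ι
  suffices H : ∀ s : Finset ι, r (φ c) (φ (s.piecewise c' c)) by
    simpa using H Finset.univ
  intro s
  induction s using Finset.induction_on with
  | empty => simpa using hr _
  | insert i s hi ih =>
    refine ht _ _ _ ih ?_
    have h1 := h (s.piecewise c' c) i _ _ (hc i)
    rw [← Finset.piecewise_insert] at h1
    have h2 : s.piecewise c' c i = c i := by simp [hi]
    rwa [← h2, Function.update_eq_self] at h1

namespace Term

variable {Ω : Signature.{u}} {X : Type} {A : Type v}
  (F : ∀ p : Ω.double.ops, (Fin (Ω.double.arity p) → A) → A)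

/-- The identities `f^i(…, g^l(…), …) = f^i(…, g^p(…), …)` with `g` in a position `j ≠ i`. -/
def ZeroIdentities : Prop :=
  ∀ (f g : Ω.ops) (i j : Fin (Ω.arity f)), i ≠ j → ∀ (l p : Fin (Ω.arity g))
    (b : Fin (Ω.arity f) → A) (c : Fin (Ω.arity g) → A),
    F ⟨f, i⟩ (Function.update b j (F ⟨g, l⟩ c)) = F ⟨f, i⟩ (Function.update b j (F ⟨g, p⟩ c))

/-- Two elements are interchangeable if they are so in all positions that are not emphasized. -/
def Interchangeable (x y : A) : Prop :=
  ∀ (f : Ω.ops) (i j : Fin (Ω.arity f)), i ≠ j → ∀ b : Fin (Ω.arity f) → A,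
    F ⟨f, i⟩ (Function.update b j x) = F ⟨f, i⟩ (Function.update b j y)

variable {F}

/-- In a position that is not emphasized the superscript of `g` may be altered freely. An argument
standing in the emphasized place `l` is therefore exchanged by first moving the superscript
elsewhere and moving it back afterwards. -/
theorem interchangeable_op (hF : ZeroIdentities F) (g : Ω.ops) (l p : Fin (Ω.arity g))
    (c c' : Fin (Ω.arity g) → A) (h : ∀ r, Interchangeable F (c r) (c' r)) :
    Interchangeable F (F ⟨g, l⟩ c) (F ⟨g, p⟩ c') := by
  have key : Interchangeable F (F ⟨g, l⟩ c) (F ⟨g, l⟩ c') := by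
    refine rel_of_forall_update (ι := Fin (Ω.arity g)) (fun c => F ⟨g, l⟩ c) (Interchangeable F) (fun _ _ _ _ _ _ => rfl)
      (fun _ _ _ h h' f i j hij b => (h f i j hij b).trans (h' f i j hij b))
      (fun _ => Interchangeable F) (fun c r x y hxy f i j hij b => ?_) c c' h
    by_cases hr : l = r
    -- Arities are at least two, so there is another place for the superscript.
    · obtain ⟨q, hq⟩ : ∃ q, q ≠ r := by
        have : Nontrivial (Fin (Ω.arity g)) := Fin.nontrivial_iff_two_le.2 (Ω.two_le g)
        exact exists_ne r
      exact (hF f g i j hij l q b _).trans ((congrArg (fun z => F ⟨f, i⟩ (Function.update b j z))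
        (hxy g q r hq c)).trans (hF f g i j hij q l b _))
    · exact congrArg (fun z => F ⟨f, i⟩ (Function.update b j z)) (hxy g l r hr c)
  exact fun f i j hij b => (key f i j hij b).trans (hF f g i j hij l p b c')

theorem interchangeable_of_forget_eq (hF : ZeroIdentities F) (a : X → A)
    (t t' : Term Ω.double X) (h : t.forget = t'.forget) :
    Interchangeable F (t.eval F a) (t'.eval F a) := by
  induction t generalizing t' with
  | var x =>
    cases t' with
    | var y =>
      obtain rfl : x = y := by simpa [forget] using h
      exact fun _ _ _ _ _ => rfl
    | op p ts => simp [forget] at h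
  | op p ts ih =>
    cases t' with
    | var y => simp [forget] at h
    | op p' ts' =>
      obtain ⟨g, l⟩ := p
      obtain ⟨g', l'⟩ := p'
      simp only [forget, op.injEq] at h
      obtain ⟨rfl, h⟩ := h
      exact interchangeable_op hF g l l' _ _ fun r => ih r _ (congrFun (eq_of_heq h) r)

theorem count_emph (t : Term Ω.double X) : t.count t.emph ≠ 0 := by
  induction t with
  | var x => simp [emph, count]
  | op p ts ih =>
    have := count_le_op p ts p.2 (ts p.2).emph
    have := ih p.2
    change (op p ts).count (ts p.2).emph ≠ 0
    omega

/-- Along the path to the emphasized leaf the superscripts are forced, because that leaf occurs in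
one branch only; off the path they are immaterial by `interchangeable_of_forget_eq`. The bound `≤ 1`
on occurrences, unlike polylinearity, is inherited by branches. -/
theorem eval_eq_of_forget_eq (hF : ZeroIdentities F) (a : X → A) (t t' : Term Ω.double X)
    (h : t.forget = t'.forget) (he : t.emph = t'.emph) (hl : ∀ x, t.count x ≤ 1) :
    t.eval F a = t'.eval F a := by
  induction t generalizing t' with
  | var x =>
    cases t' with
    | var y =>
      obtain rfl : x = y := by simpa [forget] using h
      rfl
    | op p ts => simp [forget] at h
  | op p ts ih =>
    cases t' with
    | var y => simp [forget] at h
    | op p' ts' =>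
      obtain ⟨g, l⟩ := p
      obtain ⟨g', l'⟩ := p'
      simp only [forget, op.injEq] at h
      obtain ⟨rfl, h⟩ := h
      have hr : ∀ r, (ts r).forget = (ts' r).forget := congrFun (eq_of_heq h)
      change (ts l).emph = (ts' l').emph at he
      have hc : ∀ r x, (ts r).count x = (ts' r).count x := fun r x => by
        rw [← count_forget, hr, count_forget]
      -- The branch `i` containing the common emphasized leaf is unique, so `l` and `l'` both equal
      -- `i`.
      obtain ⟨i, -, hi⟩ := exists_branch (Ω := Ω.double) (f := ⟨g, l⟩) (ts := ts)
        (x := (ts l).emph) (le_antisymm (hl _) (Nat.one_le_iff_ne_zero.2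
          (count_emph (op (Ω := Ω.double) ⟨g, l⟩ ts))))
      have h1 : l = i := by
        by_contra hne
        exact count_emph (ts l) (hi l hne)
      have h2 : l' = i := by
        by_contra hne
        have h0 : (ts' l').count (ts' l').emph = 0 := by
          rw [← he]
          exact (hc l' _).symm.trans (hi l' hne)
        exact count_emph (ts' l') h0
      subst h2
      subst h1
      refine rel_of_forall_update (ι := Fin (Ω.arity g)) (F ⟨g, l⟩) Eq (fun _ => rfl) (fun _ _ _ => Eq.trans)
        -- The emphasized argument must be preserved exactly; the other arguments only up to
        -- interchangeability.
        (fun r x y => if r = l then x = y else Interchangeable F x y) (fun c r x y hxy => ?_)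
        _ _ fun r => ?_
      · split_ifs at hxy with hrl
        · rw [hxy]
        · exact hxy g l r (Ne.symm hrl) c
      · split_ifs with hrl
        · subst hrl
          exact ih _ _ (hr _) he fun x => (count_le_op _ ts _ x).trans (hl x)
        · exact interchangeable_of_forget_eq hF a _ _ (hr r)

theorem emph_dot (x : X) (t : Term Ω X) (h : t.count x ≠ 0) : (t.dot x).emph = x := by
  induction t with
  | var y =>
    by_contra hne
    change ¬y = x at hne
    exact h (by simpa [count] using hne)
  | op f ts ih =>
    have hex : ∃ j, (ts j).count x ≠ 0 := by
      obtain ⟨j, -, hj⟩ := Finset.exists_ne_zero_of_sum_ne_zero h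
      exact ⟨j, hj⟩
    simp only [dot, emph]
    rw [dif_pos hex]
    exact ih _ hex.choose_spec

end Term

/-! ### Monomials modulo the identities with interchangeable superscripts. -/

section

variable {k : Type u} [Field k] {Ω : Signature.{u}}

/-- Modulo the identities with interchangeable superscripts, a monomial is determined by its
emphasized leaf and the monomial without superscripts. -/
theorem mono_sub_mono_mem (N : Operad.OpIdeal (Free k Ω.double))
    (hN : ∀ (f g : Ω.ops) (i j : Fin (Ω.arity f)), i ≠ j → ∀ l p : Fin (Ω.arity g),
      nestedMon k Ω f g i j l - nestedMon k Ω f g i j p ∈ N.carrier _)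
    {I : Type} [Finite I] (t t' : Term Ω.double I) (ht : t.Polylinear) (ht' : t'.Polylinear)
    (h : t.forget = t'.forget) (he : t.emph = t'.emph) :
    mono k t ht - mono k t' ht' ∈ N.carrier I := by
  -- Membership in `N` means being zero in the quotient operad, which is tested on all algebras over
  -- it. The ideal-theoretic claim thus becomes the equality of values `Term.eval_eq_of_forget_eq`.
  refine (Submodule.Quotient.mk_eq_zero _).1
    (eq_zero_of_forall_satisfies (R := (Free k Ω.double).quotient N) _ fun B a => ?_)
  let A : Alg (Free k Ω.double) := ⟨B.carrier, B.str.comp (Operad.quotientMk _ N)⟩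
  have hsub : ∀ {J : Type} [Finite J] (f g : (Free k Ω.double).obj J) (a : J → B.carrier),
      A.act (f - g) a = A.act f a - A.act g a := by
    intro J _ f g a
    unfold Alg.act
    rw [map_sub]
    rfl
  change A.act (mono k t ht - mono k t' ht') a = 0
  rw [hsub, act_mono, act_mono, sub_eq_zero]
  refine Term.eval_eq_of_forget_eq ?_ a t t' h he fun x => (ht x).le
  intro f g i j hij l p b c
  have h0 : ∀ a, A.act (nestedMon k Ω f g i j l - nestedMon k Ω f g i j p) a = 0 := by
    intro a
    have hz : ∀ {J : Type} [Finite J] (a : J → B.carrier), B.act 0 a = 0 := by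
      intro J _ a
      unfold Alg.act
      rw [map_zero]
      rfl
    exact (congrArg (fun z => B.act z a)
      ((Submodule.Quotient.mk_eq_zero _).2 (hN f g i j hij l p))).trans (hz a)
  -- The entry of `b` at `j` is not used: the value of the inner symbol takes its place.
  have h1 := h0 (Sum.elim (fun s => b s.1) c)
  rw [hsub, sub_eq_zero, nestedMon, nestedMon, act_mono, act_mono] at h1
  have h2 : ∀ l : Fin (Ω.arity g), (nested Ω f g i j l).eval
      (fun f b => A.act (gen k f) b) (Sum.elim (fun s => b s.1) c) =
      A.act (gen k (Ω := Ω.double) ⟨f, i⟩)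
        (Function.update b j (A.act (gen k (Ω := Ω.double) ⟨g, l⟩) c)) := by
    intro l
    refine congrArg (A.act (gen k (Ω := Ω.double) ⟨f, i⟩)) 
      (funext fun s : Fin (Ω.arity f) => ?_)
    by_cases hs : s = j
    · subst hs
      refine (congrArg (Term.eval _ _) (dif_pos rfl)).trans ?_
      exact (Function.update_self (β := fun _ => B.carrier) s _ b).symm
    · refine (congrArg (Term.eval _ _) (dif_neg hs)).trans ?_
      exact (Function.update_of_ne (β := fun _ => B.carrier) hs _ b).symm
  rwa [h2, h2] at h1

end

end Dialg

namespace Dialg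

universe v w

/-! ### Monomials without superscripts -/

section

variable {k : Type u} [Field k] {Ω : Signature.{u}} {I : Type} [Finite I]

open Classical in
/-- The component at `e_x` of the image of a polynomial under `zeta`. -/
noncomputable def coordLin (x : I) : (Free k Ω.double).obj I →ₗ[k] (Free k Ω).obj I :=
  freeLift fun t => if t.1.emph = x then mono k t.1.forget t.2.forget else 0

open Classical in
theorem coordLin_mono (x : I) (t : Term Ω.double I) (ht : t.Polylinear) :
    coordLin x (mono k t ht) = if t.emph = x then mono k t.forget ht.forget else 0 :=
  freeLift_mono _ t ht

theorem dotLin_mono (x : I) (t : Term Ω I) (ht : t.Polylinear) :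
    dotLin Ω x (mono k t ht) = mono k (t.dot x) (ht.dot x) :=
  Finsupp.mapDomain_single

-- The superscripts added by `dotLin Ω i` all lead to the leaf `i`, and erasing them gives `s` back;
-- hence only the coordinate at `i` is nonzero.
open Classical in
theorem coordLin_dotLin (x i : I) (s : (Free k Ω).obj I) :
    coordLin x (dotLin Ω i s) = if i = x then s else 0 := by
  have h : coordLin x ∘ₗ dotLin Ω i = if i = x then LinearMap.id (R := k) (M := (Free k Ω).obj I)
      else 0 := by
    refine free_hom_ext fun t ht => ?_
    rw [LinearMap.comp_apply, dotLin_mono, coordLin_mono,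
      Term.emph_dot i t ((ht i).trans_ne one_ne_zero)]
    split_ifs
    · exact mono_congr k (Term.forget_dot i t) _ _
    · rfl
  have h1 := LinearMap.congr_fun h s
  rw [LinearMap.comp_apply] at h1
  rw [h1]
  split_ifs <;> rfl

/-- As `i ≠ j`, the path from the root never enters `g`: both monomials have the emphasized leaf in
position `i`, and they agree once the superscripts are erased. -/
theorem coordLin_nestedMon (f g : Ω.ops) (i j : Fin (Ω.arity f)) (hij : i ≠ j)
    (l p : Fin (Ω.arity g)) (x : {s : Fin (Ω.arity f) // s ≠ j} ⊕ Fin (Ω.arity g)) :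
    coordLin x (nestedMon k Ω f g i j l - nestedMon k Ω f g i j p) = 0 := by
  classical
  have he : ∀ l, (nested Ω f g i j l).emph = Sum.inl ⟨i, hij⟩ := by
    intro l
    exact congrArg Term.emph (dif_neg hij)
  have hf : ∀ l, (nested Ω f g i j l).forget = Term.op f (fun s =>
      if h : s = j then Term.op g (fun r => Term.var (Sum.inr r))
      else Term.var (Sum.inl ⟨s, h⟩)) := by
    intro l
    refine congrArg (Term.op f) (funext fun s : Fin (Ω.arity f) => ?_)
    by_cases hs : s = j
    · refine (congrArg Term.forget (dif_pos hs)).trans ?_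
      rw [dif_pos hs]
      rfl
    · refine (congrArg Term.forget (dif_neg hs)).trans ?_
      rw [dif_neg hs]
      rfl
  rw [map_sub, nestedMon, nestedMon, coordLin_mono, coordLin_mono, he, he, sub_eq_zero]
  split_ifs
  · exact mono_congr k ((hf l).trans (hf p).symm) _ _
  · rfl

end

/-! ### Membership in the ideal `S^(2)`. -/

section

variable {k : Type u} [Field k] {Ω : Signature.{u}}

theorem Operad.OpIdeal.subset_span {P : Operad.{u, v} k}
    (G : ∀ (I : Type) [Finite I], Set (P.obj I)) {I : Type} [Finite I] {f : P.obj I}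
    (hf : f ∈ G I) : f ∈ (Operad.OpIdeal.span G).carrier I := by
  refine Submodule.mem_sInf.2 ?_
  rintro _ ⟨N, hN, rfl⟩
  exact hN I hf

theorem Operad.OpIdeal.span_le {P : Operad.{u, v} k}
    {G : ∀ (I : Type) [Finite I], Set (P.obj I)} (N : Operad.OpIdeal P)
    (hN : ∀ (J : Type) [Finite J], G J ⊆ (N.carrier J : Set (P.obj J))) (I : Type) [Finite I] :
    (Operad.OpIdeal.span G).carrier I ≤ N.carrier I :=
  sInf_le ⟨N, hN, rfl⟩

/-- Modulo the first kind of generators, a monomial equals the standard dotted monomial with the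
same emphasized leaf and the same underlying term. So `f` is congruent to the sum of its dotted
coordinates, each of which is a generator of the second kind. -/
theorem mem_doubleIdeal_of_coordLin {S : ∀ n : ℕ, Set ((Free k Ω).obj (Fin n))} {d : ℕ}
    (f : (Free k Ω.double).obj (Fin d)) (hf : ∀ x, coordLin x f ∈ S d) :
    f ∈ (doubleIdeal S).carrier (Fin d) := by
  have h1 : ∑ x, dotLin Ω x (coordLin x f) ∈ (doubleIdeal S).carrier (Fin d) :=
    Submodule.sum_mem _ fun x _ => Operad.OpIdeal.subset_span _ (DoubleGen.dot d _ (hf x) x)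
  have h2 : f - ∑ x, dotLin Ω x (coordLin x f) ∈ (doubleIdeal S).carrier (Fin d) := by
    -- The congruence holds for every `f`, so the induction is not burdened with the hypothesis on
    -- coordinates, which need not pass to summands.
    clear h1 hf
    induction f using free_induction with
    | zero => simp
    | add f g hf hg =>
      have h := add_mem hf hg
      simp only [map_add, Finset.sum_add_distrib]
      rwa [add_sub_add_comm]
    | smul_mono c t ht =>
      simp only [map_smul, ← Finset.smul_sum, ← smul_sub]
      refine Submodule.smul_mem _ _ ?_
      rw [Finset.sum_eq_single t.emph]
      · rw [coordLin_mono, if_pos rfl, dotLin_mono]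
        refine mono_sub_mono_mem (doubleIdeal S) (fun f g i j hij l p =>
          Operad.OpIdeal.subset_span _ (DoubleGen.zero f g i j hij l p)) _ _ _ _ ?_ ?_
        · rw [Term.forget_dot]
        · rw [Term.emph_dot]
          rw [Term.count_forget, ht]
          exact one_ne_zero
      · intro x _ hx
        rw [coordLin_mono, if_neg hx.symm, map_zero]
      · simp
  have h3 := add_mem h2 h1
  rwa [sub_add_cancel] at h3

end

/-! ### Words in associative algebras and dialgebras -/

/-- Associativity regroups the word around the chosen center `c`, giving the bracketing used in
`AssocDialgebra.word`. -/
theorem wordProd_append {A : Type v} [NonUnitalRing A] (l l' : List A) (c : A) :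
    wordProd (l ++ c :: l') = l.foldr (fun x y => x * y) (l'.foldl (fun x y => x * y) c) := by
  have hmul : ∀ (l : List A) (x y : A),
      l.foldl (fun x y => x * y) (x * y) = x * l.foldl (fun x y => x * y) y := by
    intro l
    induction l with
    | nil => exact fun _ _ => rfl
    | cons z l ih =>
      intro x y
      rw [List.foldl_cons, List.foldl_cons, mul_assoc, ih]
  induction l with
  | nil => rfl
  | cons x l ih =>
    rw [List.foldr_cons, ← ih]
    cases l with
    | nil => exact hmul l' x c
    | cons y l => exact hmul _ x y

theorem finRange_eq_append {n : ℕ} (j : Fin n) : List.finRange n =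
    (List.finRange n).take j ++ j :: (List.finRange n).drop (j + 1) := by
  conv_lhs => rw [← List.take_append_drop j (List.finRange n)]
  rw [List.drop_eq_getElem_cons (by simp)]
  simp

theorem wordProd_ofFn {A : Type v} [NonUnitalRing A] {n : ℕ} (g : Fin n → A) (j : Fin n) :
    wordProd (List.ofFn g) = ((List.finRange n).take j).foldr (fun s y => g s * y)
      (((List.finRange n).drop (j + 1)).foldl (fun y s => y * g s) (g j)) := by
  rw [List.ofFn_eq_map]
  conv_lhs => rw [finRange_eq_append j]
  rw [List.map_append, List.map_cons, wordProd_append, List.foldr_map, List.foldl_map]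

section

variable {k : Type u} [Field k]

section

variable {n : ℕ} (hn : 2 ≤ n) (α : Equiv.Perm (Fin n) → k) {X : Type} [Finite X]

/-- The values of polylinear polynomials in the algebra `(A, ω)`. -/
noncomputable def assocEval {A : Type v} [NonUnitalRing A] [Module k A] (a : X → A) :
    (Free k (Signature.single n hn)).obj X →ₗ[k] A :=
  evalPolyLin (Ω := Signature.single n hn) (fun _ => assocOp α) a

theorem assocEval_apply {A : Type v} [NonUnitalRing A] [Module k A] (a : X → A)
    (f : (Free k (Signature.single n hn)).obj X) : assocEval hn α a f =
      evalPoly (Ω := Signature.single n hn) (fun _ => assocOp α) a f :=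
  evalPolyLin_apply _ a f

theorem assocEval_mono {A : Type v} [NonUnitalRing A] [Module k A] (a : X → A)
    (t : Term (Signature.single n hn) X) (ht : t.Polylinear) : assocEval hn α a (mono k t ht) =
      t.eval (Ω := Signature.single n hn) (fun _ => assocOp α) a :=
  (assocEval_apply hn α a _).trans (evalPoly_mono _ a t ht)

/-- The values of polylinear polynomials in the algebra `(D, ω_1, …, ω_n)`. -/
noncomputable def bsoEval (D : AssocDialgebra k) (a : X → D.carrier) :
    (Free k (Signature.single n hn).double).obj X →ₗ[k] D.carrier :=
  evalPolyLin (Ω := (Signature.single n hn).double) (fun p => D.bsoOp α p.2) a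

theorem bsoEval_apply (D : AssocDialgebra k) (a : X → D.carrier)
    (f : (Free k (Signature.single n hn).double).obj X) : bsoEval hn α D a f =
      evalPoly (Ω := (Signature.single n hn).double) (fun p => D.bsoOp α p.2) a f :=
  evalPolyLin_apply _ a f

theorem bsoEval_mono (D : AssocDialgebra k) (a : X → D.carrier)
    (t : Term (Signature.single n hn).double X) (ht : t.Polylinear) :
    bsoEval hn α D a (mono k t ht) =
      t.eval (Ω := (Signature.single n hn).double) (fun p => D.bsoOp α p.2) a :=
  (bsoEval_apply hn α D a _).trans (evalPoly_mono _ a t ht)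

end

/-! ### Evaluating dialgebra polynomials through bimodule maps. -/

namespace AssocDialgebra

/-- A linear map `φ` from a dialgebra to an associative algebra compatible with both products, and
a linear map `ψ` which maps `⊢` and `⊣` to the left and the right multiplication by images of
`φ`. -/
structure IsBimoduleMap (D : AssocDialgebra k) {A : Type v} [NonUnitalRing A] [Module k A]
    (φ ψ : D.carrier →ₗ[k] A) : Prop where
  map_lt : ∀ a b, φ (D.lt a b) = φ a * φ b
  map_rt : ∀ a b, φ (D.rt a b) = φ a * φ b
  map_lt' : ∀ a b, ψ (D.lt a b) = φ a * ψ b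
  map_rt' : ∀ a b, ψ (D.rt a b) = ψ a * φ b

variable {D : AssocDialgebra k} {A : Type v} [NonUnitalRing A] [Module k A]
  {φ ψ : D.carrier →ₗ[k] A}

theorem IsBimoduleMap.self (h : D.IsBimoduleMap φ ψ) : D.IsBimoduleMap φ φ :=
  ⟨h.map_lt, h.map_rt, h.map_lt, h.map_rt⟩

/-- At each product `ψ` is passed to the factor containing the center and `φ` to the other one, so
`ψ` ends up on the center alone. -/
theorem IsBimoduleMap.map_word (h : D.IsBimoduleMap φ ψ) {n : ℕ} (x : Fin n → D.carrier)
    (σ : Equiv.Perm (Fin n)) (j : Fin n) :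
    ψ (D.word x σ j) =
      wordProd (List.ofFn fun s => if s = j then ψ (x (σ s)) else φ (x (σ s))) := by
  -- Without repetitions in the list of positions, `j` appears neither before nor after the center,
  -- which settles every case distinction in the folds.
  have hn := List.nodup_finRange n
  rw [finRange_eq_append j, List.nodup_append, List.nodup_cons] at hn
  have h1 : ∀ (l : List (Fin n)), j ∉ l → ∀ y, ψ (l.foldr (fun s y => D.lt (x (σ s)) y) y) =
      l.foldr (fun s y => (if s = j then ψ (x (σ s)) else φ (x (σ s))) * y) (ψ y) := by
    intro l hl y
    induction l with
    | nil => rfl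
    | cons s l ih =>
      rw [List.mem_cons, not_or] at hl
      rw [List.foldr_cons, List.foldr_cons, h.map_lt', ih hl.2, if_neg (Ne.symm hl.1)]
  have h2 : ∀ (l : List (Fin n)), j ∉ l → ∀ y, ψ (l.foldl (fun y s => D.rt y (x (σ s))) y) =
      l.foldl (fun y s => y * (if s = j then ψ (x (σ s)) else φ (x (σ s)))) (ψ y) := by
    intro l hl
    induction l with
    | nil => exact fun _ => rfl
    | cons s l ih =>
      intro y
      rw [List.mem_cons, not_or] at hl
      rw [List.foldl_cons, List.foldl_cons, ih hl.2, h.map_rt', if_neg (Ne.symm hl.1)]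
  rw [wordProd_ofFn _ j, word, h1 _ fun hj => hn.2.2 j hj j (by simp) rfl, h2 _ hn.2.1.1]
  simp

theorem IsBimoduleMap.map_bsoOp (h : D.IsBimoduleMap φ ψ) {n : ℕ}
    (α : Equiv.Perm (Fin n) → k) (i : Fin n) (x : Fin n → D.carrier) :
    ψ (D.bsoOp α i x) = assocOp α fun s => if s = i then ψ (x s) else φ (x s) := by
  rw [bsoOp, assocOp, map_sum]
  refine Finset.sum_congr rfl fun σ _ => ?_
  rw [map_smul, h.map_word]
  -- The center is in position `σ⁻¹ i`, so marking the position becomes marking the variable `x i`,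
  -- uniformly in `σ`.
  simp only [Equiv.eq_symm_apply]

variable {n : ℕ} (hn : 2 ≤ n) (α : Equiv.Perm (Fin n) → k) {X : Type}

/-- With `ψ = φ` no factor is distinguished, so all `ω_i` are sent to the same operation `ω` and the
superscripts lose their effect. -/
theorem IsBimoduleMap.map_eval_self (h : D.IsBimoduleMap φ ψ) (a : X → D.carrier)
    (t : Term (Signature.single n hn).double X) :
    φ (t.eval
        (Ω := (Signature.single n hn).double) (fun p => D.bsoOp α p.2) a) =
      t.forget.eval (Ω := Signature.single n hn) (fun _ => assocOp α) (fun x => φ (a x)) := by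
  induction t with
  | var x => rfl
  | op p ts ih =>
    refine (h.self.map_bsoOp α p.2 _).trans ?_
    change assocOp α _ = assocOp α fun s : Fin n => (ts s).forget.eval
      (Ω := Signature.single n hn) (fun _ => assocOp α) (fun x => φ (a x))
    congr 1
    funext s
    rw [ite_self]
    exact ih s

/-- The map `ψ` follows the superscripts down to the emphasized leaf, while `φ` is applied to every
branch left aside. -/
theorem IsBimoduleMap.map_eval [DecidableEq X] (h : D.IsBimoduleMap φ ψ) (a : X → D.carrier)
    (t : Term (Signature.single n hn).double X) (ht : ∀ x, t.count x ≤ 1) :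
    ψ (t.eval
        (Ω := (Signature.single n hn).double) (fun p => D.bsoOp α p.2) a) =
      t.forget.eval (Ω := Signature.single n hn) (fun _ => assocOp α)
        (Function.update (fun x => φ (a x)) t.emph (ψ (a t.emph))) := by
  induction t with
  | var x => simp [Term.eval, Term.forget, Term.emph]
  | op p ts ih =>
    refine (h.map_bsoOp α p.2 _).trans ?_
    change assocOp α _ = assocOp α fun s : Fin n => (ts s).forget.eval
      (Ω := Signature.single n hn) (fun _ => assocOp α)
      (Function.update (fun x => φ (a x)) (ts p.2).emph (ψ (a (ts p.2).emph)))
    congr 1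
    funext s
    obtain ⟨i, -, hi⟩ := Term.exists_branch (ts := ts) (x := (ts p.2).emph)
      (le_antisymm (ht _) (Nat.one_le_iff_ne_zero.2 (Term.count_emph (Term.op p ts))))
    have h1 : p.2 = i := by
      by_contra hne
      exact Term.count_emph (ts p.2) (hi p.2 hne)
    split_ifs with hs
    · subst hs
      exact ih _ fun x => (Term.count_le_op _ ts _ x).trans (ht x)
    -- The emphasized leaf does not occur in a branch off the path, so changing its value there is
    -- harmless.
    · refine (h.map_eval_self hn α a (ts s)).trans (Term.eval_congr _ _ _ _ fun x hx => ?_)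
      refine (Function.update_of_ne (β := fun _ => A) ?_ _ (fun x => φ (a x))).symm
      rintro rfl
      rw [Term.count_forget] at hx
      exact hx (hi s fun h => hs (h.trans h1.symm))

/-- This formula serves both inclusions: it expresses values in a dialgebra by values of the
coordinates of `f` in an associative algebra. -/
theorem IsBimoduleMap.map_bsoEval [DecidableEq X] [Fintype X] (h : D.IsBimoduleMap φ ψ)
    (a : X → D.carrier) (f : (Free k (Signature.single n hn).double).obj X) :
    ψ (bsoEval hn α D a f) =
      ∑ x, assocEval hn α (Function.update (fun x => φ (a x)) x (ψ (a x))) (coordLin x f) := by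
  induction f using free_induction with
  | zero => simp
  | add f g hf hg => simp only [map_add, hf, hg, Finset.sum_add_distrib]
  | smul_mono c t ht =>
    simp only [map_smul, ← Finset.smul_sum]
    congr 1
    rw [Finset.sum_eq_single t.emph]
    · rw [coordLin_mono, if_pos rfl, assocEval_mono, bsoEval_mono]
      exact h.map_eval hn α a t fun x => (ht x).le
    · intro x _ hx
      rw [coordLin_mono, if_neg hx.symm, map_zero]
    · simp

end AssocDialgebra

/-! ### The split null extension of a dialgebra -/

namespace AssocDialgebra

variable (D : AssocDialgebra k)

/-- The subspace spanned by all `a ⊢ b - a ⊣ b`. -/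
def zeroSubmodule : Submodule k D.carrier :=
  Submodule.span k (Set.range fun p : D.carrier × D.carrier => D.lt p.1 p.2 - D.rt p.1 p.2)

theorem zeroSubmodule_le {M : Type*} [AddCommGroup M] [Module k M] (φ : D.carrier →ₗ[k] M)
    (h : ∀ a b, φ (D.lt a b) = φ (D.rt a b)) : D.zeroSubmodule ≤ LinearMap.ker φ := by
  refine Submodule.span_le.2 ?_
  rintro _ ⟨⟨a, b⟩, rfl⟩
  exact LinearMap.sub_mem_ker_iff.2 (h a b)

/-- The associative quotient of a dialgebra. -/
abbrev Bar : Type u := D.carrier ⧸ D.zeroSubmodule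

theorem mkQ_lt (a b : D.carrier) :
    D.zeroSubmodule.mkQ (D.lt a b) = D.zeroSubmodule.mkQ (D.rt a b) :=
  (Submodule.Quotient.eq _).2 (Submodule.subset_span ⟨(a, b), rfl⟩)

/-- The left action of the associative quotient. -/
def leftAct : D.Bar →ₗ[k] D.carrier →ₗ[k] D.carrier :=
  D.zeroSubmodule.liftQ D.lt (D.zeroSubmodule_le _ fun a b =>
    LinearMap.ext fun c => (D.rt_lt a b c).symm)

/-- The right action of the associative quotient. -/
def rightAct : D.Bar →ₗ[k] D.carrier →ₗ[k] D.carrier :=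
  D.zeroSubmodule.liftQ D.rt.flip (D.zeroSubmodule_le _ fun a b =>
    LinearMap.ext fun c => D.rt_rt_lt c a b)

/-- The product of the associative quotient. -/
def barMul : D.Bar →ₗ[k] D.Bar →ₗ[k] D.Bar :=
  D.zeroSubmodule.liftQ
    ((D.zeroSubmodule.liftQ (D.lt.compr₂ D.zeroSubmodule.mkQ).flip
      (D.zeroSubmodule_le _ fun a b => LinearMap.ext fun c => by
        simp only [LinearMap.flip_apply, LinearMap.compr₂_apply]
        -- Here `c ⊢ (a ⊢ b)` and `c ⊢ (a ⊣ b)` are `(c ⊢ a) ⊢ b` and `(c ⊢ a) ⊣ b`, which coincide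
        -- in the quotient.
        rw [D.lt_assoc, D.lt_rt_assoc, D.mkQ_lt])).flip)
    (D.zeroSubmodule_le _ fun a b => by
      refine LinearMap.ext fun c => ?_
      obtain ⟨c, rfl⟩ := Submodule.mkQ_surjective _ c
      exact congrArg _ (D.rt_lt a b c).symm)

/-- The split null extension of the associative quotient by the dialgebra. -/
def Split : Type u := D.Bar × D.carrier

instance : AddCommGroup D.Split := inferInstanceAs (AddCommGroup (D.Bar × D.carrier))

instance : Module k D.Split := inferInstanceAs (Module k (D.Bar × D.carrier))

/-- The dialgebra is a bimodule over its quotient, and two elements of the bimodule have product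
zero. -/
instance : Mul D.Split :=
  ⟨fun p q => (D.barMul p.1 q.1, D.leftAct p.1 q.2 + D.rightAct q.1 p.2)⟩

instance : NonUnitalRing D.Split where
  left_distrib p q r := by
    refine Prod.ext (map_add (D.barMul p.1) q.1 r.1) ?_
    change D.leftAct p.1 (q.2 + r.2) + D.rightAct (q.1 + r.1) p.2 =
      (D.leftAct p.1 q.2 + D.rightAct q.1 p.2) + (D.leftAct p.1 r.2 + D.rightAct r.1 p.2)
    rw [map_add, map_add, LinearMap.add_apply]
    abel
  right_distrib p q r := by
    refine Prod.ext (LinearMap.map_add₂ D.barMul p.1 q.1 r.1) ?_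
    change D.leftAct (p.1 + q.1) r.2 + D.rightAct r.1 (p.2 + q.2) =
      (D.leftAct p.1 r.2 + D.rightAct r.1 p.2) + (D.leftAct q.1 r.2 + D.rightAct r.1 q.2)
    rw [map_add, map_add, LinearMap.add_apply]
    abel
  zero_mul p := by
    refine Prod.ext (LinearMap.map_zero₂ D.barMul p.1) ?_
    change D.leftAct 0 p.2 + D.rightAct p.1 0 = 0
    simp
  mul_zero p := by
    refine Prod.ext (map_zero (D.barMul p.1)) ?_
    change D.leftAct p.1 0 + D.rightAct 0 p.2 = 0
    simp
  mul_assoc p q r := by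
    obtain ⟨p, d⟩ := p
    obtain ⟨q, e⟩ := q
    obtain ⟨r, f⟩ := r
    obtain ⟨a, rfl⟩ := Submodule.mkQ_surjective _ p
    obtain ⟨b, rfl⟩ := Submodule.mkQ_surjective _ q
    obtain ⟨c, rfl⟩ := Submodule.mkQ_surjective _ r
    refine Prod.ext (congrArg D.zeroSubmodule.mkQ (D.lt_assoc a b c).symm) ?_
    change D.lt (D.lt a b) f + D.rt (D.lt a e + D.rt d b) c =
      D.lt a (D.lt b f + D.rt e c) + D.rt d (D.lt b c)
    -- The three summands are the left, right and mixed associativity laws of a bimodule, and these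
    -- are dialgebra axioms.
    rw [map_add, map_add, LinearMap.add_apply, D.rt_rt_lt, D.rt_assoc, D.lt_assoc,
      D.lt_rt_assoc, add_assoc]

instance : IsScalarTower k D.Split D.Split where
  smul_assoc c p q := by
    refine Prod.ext (LinearMap.map_smul₂ D.barMul c p.1 q.1) ?_
    change D.leftAct (c • p.1) q.2 + D.rightAct q.1 (c • p.2) =
      c • (D.leftAct p.1 q.2 + D.rightAct q.1 p.2)
    rw [map_smul, map_smul, LinearMap.smul_apply, smul_add]

instance : SMulCommClass k D.Split D.Split where
  smul_comm c p q := by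
    refine Prod.ext (map_smul (D.barMul p.1) c q.1).symm ?_
    change c • (D.leftAct p.1 q.2 + D.rightAct q.1 p.2) =
      D.leftAct p.1 (c • q.2) + D.rightAct (c • q.1) p.2
    rw [map_smul, map_smul, LinearMap.smul_apply, smul_add]

/-- The homomorphism from the dialgebra to its associative quotient. -/
def splitInl : D.carrier →ₗ[k] D.Split := LinearMap.inl k D.Bar D.carrier ∘ₗ D.zeroSubmodule.mkQ

/-- The dialgebra as an ideal of the split null extension. -/
def splitInr : D.carrier →ₗ[k] D.Split := LinearMap.inr k D.Bar D.carrier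

theorem splitInr_injective : Function.Injective D.splitInr := LinearMap.inr_injective

theorem isBimoduleMap_split : D.IsBimoduleMap D.splitInl D.splitInr := by
  have h : ∀ a b, D.splitInl (D.lt a b) = D.splitInl a * D.splitInl b := fun a b => by
    refine Prod.ext rfl ?_
    change 0 = D.lt a 0 + D.rt 0 b
    simp
  refine ⟨h, fun a b => ?_, fun a b => ?_, fun a b => ?_⟩
  · rw [← h]
    exact congrArg (LinearMap.inl k D.Bar D.carrier) (D.mkQ_lt a b).symm
  · refine Prod.ext (map_zero (D.barMul _)).symm ?_
    change D.lt a b = D.lt a b + D.rightAct 0 0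
    simp
  · refine Prod.ext (LinearMap.map_zero₂ D.barMul _).symm ?_
    change D.rt a b = D.leftAct 0 0 + D.rt a b
    simp

end AssocDialgebra

/-! ### Multilinearity -/

section

variable {A : Type v} [NonUnitalRing A] [Module k A] [IsScalarTower k A A] [SMulCommClass k A A]

/-- After a unit is adjoined, words become ordinary list products, whose multilinearity is available
from `MultilinearMap.mkPiAlgebraFin`. -/
theorem inr_wordProd (l : List A) (hl : l ≠ []) :
    (Unitization.inr (wordProd l) : Unitization k A) = (l.map Unitization.inr).prod := by
  cases l with
  | nil => exact absurd rfl hl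
  | cons x l =>
    have h : ∀ (l : List A) (x : A),
        (Unitization.inr (l.foldl (fun y z => y * z) x) : Unitization k A) =
          Unitization.inr x * (l.map Unitization.inr).prod := by
      intro l
      induction l with
      | nil => simp
      | cons y l ih =>
        intro x
        rw [List.foldl_cons, ih, Unitization.inr_mul, List.map_cons, List.prod_cons, mul_assoc]
    rw [List.map_cons, List.prod_cons]
    exact h l x

/-- The operation `assocOp` as a multilinear map. -/
def assocOpMultilinear {n : ℕ} (hn : 2 ≤ n) (α : Equiv.Perm (Fin n) → k) :
    MultilinearMap k (fun _ : Fin n => A) A :=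
  -- `m` is multilinear by construction, and this descends to `assocOp` because `A` embeds in its
  -- unitization.
  let m : MultilinearMap k (fun _ : Fin n => A) (Unitization k A) :=
    ∑ σ : Equiv.Perm (Fin n), α σ • ((MultilinearMap.mkPiAlgebraFin k n
      (Unitization k A)).domDomCongr σ).compLinearMap fun _ => Unitization.inrHom k k A
  have hm : ∀ x, Unitization.inr (assocOp α x) = m x := fun x => by
    have h1 : (Unitization.inr (assocOp α x) : Unitization k A) =
        Unitization.inrHom k k A (assocOp α x) := rfl
    rw [h1, assocOp, map_sum]
    simp only [m, sum_apply, map_smul, smul_apply]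
    refine Finset.sum_congr rfl fun σ _ => congrArg (fun z => α σ • z) ?_
    refine (inr_wordProd _ (by simp; omega)).trans ?_
    simp [List.map_ofFn, Function.comp_def]
  { toFun := assocOp α
    map_update_add' := fun x i a b => Unitization.inr_injective (R := k) <| by
      rw [Unitization.inr_add, hm, hm, hm, m.map_update_add]
    map_update_smul' := fun x i c a => Unitization.inr_injective (R := k) <| by
      rw [Unitization.inr_smul, hm, hm, m.map_update_smul] }

end

/-- The operation `bsoOp` as a multilinear map. -/
def AssocDialgebra.bsoOpMultilinear (D : AssocDialgebra k) {n : ℕ} (hn : 2 ≤ n)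
    (α : Equiv.Perm (Fin n) → k) (i : Fin n) :
    MultilinearMap k (fun _ : Fin n => D.carrier) D.carrier :=
  -- The same descent, now along the embedding of the dialgebra in its split null extension.
  let m : MultilinearMap k (fun _ : Fin n => D.carrier) D.Split :=
    (assocOpMultilinear (A := D.Split) hn α).compLinearMap fun s =>
      if s = i then D.splitInr else D.splitInl
  have hm : ∀ x, D.splitInr (D.bsoOp α i x) = m x := fun x => by
    rw [D.isBimoduleMap_split.map_bsoOp]
    change assocOp α _ = assocOp α fun s => (if s = i then D.splitInr else D.splitInl) (x s)
    congr 1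
    funext s
    split_ifs <;> rfl
  { toFun := D.bsoOp α i
    map_update_add' := fun x i a b => D.splitInr_injective <| by
      rw [map_add, hm, hm, hm, m.map_update_add]
    map_update_smul' := fun x i c a => D.splitInr_injective <| by
      rw [map_smul, hm, hm, m.map_update_smul] }

/-! ### The dialgebra `A ⊗ Perm` -/

section

/-- The dialgebra of functions from a finite set to an associative algebra, in which one of the
factors of a product is replaced by the sum of its values. -/
def permDialgebra (A : Type u) [NonUnitalRing A] [Module k A] [IsScalarTower k A A]
    [SMulCommClass k A A] (X : Type) [Fintype X] : AssocDialgebra k where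
  carrier := X → A
  -- A function `a` stands for the sum of all `a x ⊗ e_x`. In `a ⊢ b` the label of `b` is kept and
  -- that of `a` is forgotten, which is summation over it.
  lt := LinearMap.mk₂ k (fun a b x => (∑ y, a y) * b x)
    (fun a a' b => by ext; simp [Finset.sum_add_distrib, add_mul])
    (fun c a b => by ext; simp [← Finset.smul_sum, smul_mul_assoc])
    (fun a b b' => by ext; simp [mul_add])
    (fun c a b => by ext; simp [mul_smul_comm])
  rt := LinearMap.mk₂ k (fun a b x => a x * ∑ y, b y)
    (fun a a' b => by ext; simp [add_mul])
    (fun c a b => by ext; simp [smul_mul_assoc])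
    (fun a b b' => by ext; simp [Finset.sum_add_distrib, mul_add])
    (fun c a b => by ext; simp [← Finset.smul_sum, mul_smul_comm])
  rt_lt a b c := by ext; simp [← Finset.mul_sum, ← Finset.sum_mul]
  rt_rt_lt a b c := by ext; simp [← Finset.mul_sum, ← Finset.sum_mul]
  lt_assoc a b c := by ext; simp [← Finset.mul_sum, mul_assoc]
  lt_rt_assoc a b c := by ext; simp [mul_assoc]
  rt_assoc a b c := by ext; simp [← Finset.sum_mul, mul_assoc]

variable {A : Type u} [NonUnitalRing A] [Module k A] [IsScalarTower k A A] [SMulCommClass k A A]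
  {X : Type} [Fintype X]

/-- The sum of the values of a function. -/
def permSum : (permDialgebra (k := k) A X).carrier →ₗ[k] A where
  toFun := fun a : X → A => ∑ y, a y
  map_add' _ _ := Finset.sum_add_distrib
  map_smul' := fun (c : k) (a : X → A) => (Finset.smul_sum (s := Finset.univ) (f := a) (r := c)).symm

/-- The value of a function at `x`. -/
def permCoord (x : X) : (permDialgebra (k := k) A X).carrier →ₗ[k] A where
  toFun := fun a : X → A => a x
  map_add' _ _ := rfl
  map_smul' _ _ := rfl

theorem isBimoduleMap_perm (x : X) :
    (permDialgebra (k := k) A X).IsBimoduleMap permSum (permCoord x) where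
  map_lt := fun a b : X → A => (Finset.mul_sum Finset.univ b (∑ y, a y)).symm
  map_rt := fun a b : X → A => (Finset.sum_mul Finset.univ a (∑ y, b y)).symm
  map_lt' := fun _ _ : X → A => rfl
  map_rt' := fun _ _ : X → A => rfl

end

/-! ### Comparison of the two sets of identities -/

variable {n : ℕ} (hn : 2 ≤ n) (α : Equiv.Perm (Fin n) → k)

theorem assocEval_eq_zero_of_arg_eq_zero {A : Type u} [NonUnitalRing A] [Module k A]
    [IsScalarTower k A A] [SMulCommClass k A A] {X : Type} [Finite X] (a : X → A) (x : X)
    (hx : a x = 0) (f : (Free k (Signature.single n hn)).obj X) : assocEval hn α a f = 0 := by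
  have h := freeStr_apply (Ω := Signature.single n hn)
    (fun _ => assocOpMultilinear (A := A) hn α) a f
  exact (assocEval_apply hn α a f).trans (h.symm.trans ((endoEval _).map_coord_zero x hx))

/-- In `A ⊗ Perm` the argument `b y ⊗ e_y` has total `b y` and is zero at every `x ≠ y`. Reading `f`
at the coordinate `x` therefore leaves just `coordLin x f` evaluated at `b`. -/
theorem coordLin_mem_idOmega {d : ℕ} {f : (Free k (Signature.single n hn).double).obj (Fin d)}
    (hf : f ∈ idBSO hn α d) (x : Fin d) : coordLin x f ∈ idOmega hn α d := by
  intro A _ _ _ _ b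
  rw [← assocEval_apply]
  let a : Fin d → (permDialgebra (k := k) A (Fin d)).carrier :=
    fun y => (Pi.single y (b y) : Fin d → A)
  have h := (isBimoduleMap_perm (k := k) (A := A) x).map_bsoEval hn α a f
  have h0 : bsoEval hn α _ a f = 0 := (bsoEval_apply hn α _ a f).trans (hf _ a)
  rw [h0, map_zero, Finset.sum_eq_single x] at h
  · refine Eq.trans (congrArg (fun c => assocEval hn α c (coordLin x f)) (funext fun y => ?_))
      h.symm
    rcases eq_or_ne y x with rfl | hy
    · rw [Function.update_self]
      exact (Pi.single_eq_same (M := fun _ => A) y (b y)).symm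
    · rw [Function.update_of_ne hy]
      change b y = ∑ z, (Pi.single y (b y) : Fin d → A) z
      simp
  -- For `y ≠ x` the replaced entry is the coordinate at `x` of `b y ⊗ e_y`, which is zero.
  · intro y _ hy
    refine assocEval_eq_zero_of_arg_eq_zero hn α _ y ?_ _
    rw [Function.update_self]
    exact Pi.single_eq_of_ne (M := fun _ => A) hy.symm _
  · simp

/-- The algebras obtained from associative dialgebras. -/
def IsBSO (B : Alg (Free k (Signature.single n hn).double)) : Prop :=
  ∃ D : AssocDialgebra k, B = ⟨D.carrier, freeStr fun p => D.bsoOpMultilinear hn α p.2⟩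

/-- This exhibits the identities of BSO algebras as an operad ideal, so that the inclusion of
`Id(ω)^(2)` need only be checked on generators. -/
theorem mem_identities_isBSO {I : Type} [Finite I]
    (f : (Free k (Signature.single n hn).double).obj I) :
    f ∈ (identities (IsBSO hn α)).carrier I ↔ ∀ (D : AssocDialgebra k) (a : I → D.carrier),
      evalPoly (Ω := (Signature.single n hn).double) (fun p => D.bsoOp α p.2) a f = 0 := by
  constructor
  · intro h D a
    refine Eq.trans ?_ (h _ ⟨D, rfl⟩ a)
    exact (freeStr_apply (fun p : (Signature.single n hn).double.ops => D.bsoOpMultilinear hn α p.2) a f).symm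
  · rintro h _ ⟨D, rfl⟩ a
    exact (freeStr_apply (fun p : (Signature.single n hn).double.ops => D.bsoOpMultilinear hn α p.2) a f).trans (h D a)

theorem idOmegaDouble_subset_idBSO (d : ℕ) : idOmegaDouble hn α d ⊆ idBSO hn α d := by
  classical
  intro f hf
  refine (mem_identities_isBSO hn α f).1 (Operad.OpIdeal.span_le _ (fun J _ g hg => ?_) _ hf)
  refine (mem_identities_isBSO hn α g).2 fun D a => ?_
  have := Fintype.ofFinite J
  -- In the split null extension the value of `g` is a sum of values of its coordinates. The
  -- coordinates of a generator of the first kind vanish; those of `s^i` are `s` or zero, and `s` is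
  -- an identity of associative algebras under `ω`.
  apply D.splitInr_injective
  rw [← bsoEval_apply, D.isBimoduleMap_split.map_bsoEval hn α a g, map_zero]
  refine Finset.sum_eq_zero fun x _ => ?_
  cases hg with
  | zero f g i j hij l p => rw [coordLin_nestedMon f g i j hij, map_zero]
  | dot m s hs i =>
    rw [coordLin_dotLin]
    split_ifs
    · rw [assocEval_apply]
      exact hs _ _
    · rw [map_zero]

theorem idBSO_eq_idOmegaDouble (d : ℕ) : idBSO hn α d = idOmegaDouble hn α d :=
  Set.Subset.antisymm
    (fun f hf => mem_doubleIdeal_of_coordLin f (coordLin_mem_idOmega hn α hf))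
    (idOmegaDouble_subset_idBSO hn α d)

end

end Dialg

theorem mainTheorem1 (k : Type u) [Field k] :
    (∀ (Ω Ξ : Signature.{u}) (P R : Operad.{u, u} k)
      (π : Operad.Hom (Free k Ω) P) (_ : π.Surjective)
      (ρ : Operad.Hom (Free k Ξ) R) (_ : ρ.Surjective)
      (ω : Operad.Hom P R),
      (CharZero k →
        ∃ e : Operad.Hom (di (specialOperad ω)) (specialOperad (diMap ω)),
          e.Bijective ∧ e.comp (diMap (specialMk ω)) = specialMk (diMap ω)) ∧
      (∀ p : ℕ, p ≠ 0 → CharP k p → ∀ d : ℕ, d < p →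
        ∀ f : (Free k Ω.double).obj (Fin d),
          (∀ A : Alg (di (specialOperad ω)), A.Satisfies
            (((diMap (specialMk ω)).comp ((diMap π).comp (zeta k Ω))).toFun (Fin d) f)) ↔
          (∀ A : Alg (specialOperad (diMap ω)), A.Satisfies
            (((specialMk (diMap ω)).comp ((diMap π).comp (zeta k Ω))).toFun (Fin d) f)))) ∧
    (∀ (n : ℕ) (hn : 2 ≤ n) (α : Equiv.Perm (Fin n) → k),
      (CharZero k → ∀ d : ℕ, idBSO hn α d = idOmegaDouble hn α d) ∧
      (∀ p : ℕ, p ≠ 0 → CharP k p → ∀ d : ℕ, d < p → idBSO hn α d = idOmegaDouble hn α d)) := by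
  refine ⟨fun Ω Ξ P R π _ ρ _ ω => ⟨fun _ => ?_, fun p _ _ d _ f => ?_⟩, fun n hn α =>
    ⟨fun _ d => idBSO_eq_idOmegaDouble hn α d, fun _ _ _ d _ => idBSO_eq_idOmegaDouble hn α d⟩⟩
  · exact Operad.Hom.exists_bijective _ _ (diMap_surjective (specialMk_surjective ω))
      (specialMk_surjective _) fun I _ a => di_special_eq_zero_iff ω a
  -- On each side, holding on all algebras means having zero image in the operad, so the equality of
  -- kernels decides.
  · rw [forall_satisfies_iff, forall_satisfies_iff]
    exact di_special_eq_zero_iff ω _
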